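/- Let $\mathbb{D}$ be the Poincaré disk and $\mathfrak H=\{x+iy: y>0\}$ the upper half-plane (metric $(dx^2+dy^2)/y^2$), identified by the isometry $g(z)=i\,\frac{1-z}{1+z}$; $\mathbb H^2\times\mathbb R$ carries the product metric $\sigma$ and $t$ denotes the height. *Tall rectangles.* For $0<d<1$ put $d_1=\sqrt{1-d}/\sqrt{1+d}$ and $\lambda_d(x)=\int_{d_1}^x \frac{2\,dv}{\sqrt{d^2(1+v^2)^2-(1-v^2)^2}}$. The tall rectangle is $$\Sigma_d=\Big\{\Big(\tfrac{x-xy^2}{x^2y^2+1},\tfrac{(x^2+1)y}{x^2y^2+1},\pm\lambda_d(x)\Big): d_1\le x<1,\ -1<y<1\Big\}\subset\mathbb D\times\mathbb R,$$ and $Y_d$ is the image of $\Sigma_d$ under the hyperbolic dilation along the geodesic $(-1,1)\subset\mathbb D$ that takes $d_1$ to $0$ (in $\mathfrak H$: $z\mapsto z/\mu$ with $g(d_1)=i\mu$), acting on the first factor. *Catenoids.* For $\kappa>0$ put $r_0=\sqrt{\kappa+1}-\sqrt\kappa$ and $t_\kappa(r)=\int_{r_0}^r\frac{2\,du}{\sqrt{4\kappa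 u^2-(1-u^2)^2}}$. Let $C_\kappa=\{(z,\pm t_\kappa(|z|)): r_0\le|z|<1\}\subset\mathbb D\times\mathbb R$ and let $\widehat C_\kappa$ be its image under the hyperbolic dilation along $(-1,1)$ that takes $r_0$ to $0$. *Parabolic catenoid.* In $\mathfrak H\times\mathbb R$ let $\mathfrak D=\{(x,\cos t,t): x\in\mathbb R,\ |t|<\pi/2\}$; its top half is the graph of $\Phi_0(x,y)=(x,y,\arccos y)$, $x\in\mathbb R$, $0<y<1$, with unit normal $\nu=(0,-y^2,-\sqrt{1-y^2})$. Then the following hold. 1. As $d\to0^+$, $Y_d$ converges to $\mathfrak D$ locally in $C^\infty$ (with multiplicity one) in $\mathfrak H\times\mathbb R$: near each point of $\mathfrak H\times\mathbb R$ there are a regular smooth defining function $F_0$ of $\mathfrak D$ and, for small $d$, smooth defining functions $F_d$ of $Y_d$ which converge to $F_0$ uniformly with all derivatives. 2. Fix $x\in\mathbb R$ and $0<y<1$. For all small $d>0$ the points of $Y_d$ above $x+iy$ are exactly those at the heights $\pm u_d(x,y)$, for some $u_d(x,y)>0$; for all small $\kappa>0$ the points of $\widehat C_\kappa$ above $x+iy$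 are exactly those at the heights $\pm c_\kappa(x,y)$, for some $c_\kappa(x,y)>0$. The deformations $\Phi_\varepsilon=(x,y,u_{\sqrt\varepsilon}(x,y))$ (so $\varepsilon=d^2$) and $\Psi_\kappa=(x,y,c_\kappa(x,y))$, extended by $\Phi_0=\Psi_0=(x,y,\arccos y)$, are differentiable at parameter $0^+$, and the associated Jacobi fields $\widehat w=\sigma(\nu,\partial_\varepsilon\Phi_\varepsilon|_{\varepsilon=0^+})$ and $w=\sigma(\nu,\partial_\kappa\Psi_\kappa|_{\kappa=0^+})$ satisfy $$\widehat w(x,y)=-\tfrac14\big(\sqrt{1-y^2}\,\arccos y-x^2y\big),\qquad \widehat w=-w.$$ Moreover $\widehat w$ solves the Jacobi equation $-(\Delta_{\mathfrak D}+\mathrm{Ric}(\nu,\nu)+|A|^2)\,\widehat w=0$ on the top half of $\mathfrak D$. -/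

import Mathlib

open Filter Topology Set
open scoped ContDiff

noncomputable section

namespace HypProd

/-- Points of `ℍ² × ℝ` are written as `(z, t) : ℂ × ℝ`, where `z` lies in the Poincaré disk
`{‖z‖ < 1}` or in the upper half-plane `{0 < Im z}`.  This is the half-plane model. -/
def halfSpace : Set (ℂ × ℝ) := {p | 0 < p.1.im}

/-- The isometry `g(z) = i (1 - z) / (1 + z)` from the Poincaré disk to the upper half-plane. -/
def cayley (z : ℂ) : ℂ := Complex.I * (1 - z) / (1 + z)

/-- The imaginary part of `g(a)`; for real `a` with `-1 < a < 1` one has `g(a) = i * cayleyIm a`. -/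
def cayleyIm (a : ℝ) : ℝ := (cayley (a : ℂ)).im

/-- A surface `S` of the disk model is carried to the half-plane model by `g × id`, and is then
moved by the horizontal hyperbolic dilation `z ↦ z / Im g(a)` along the geodesic `(-1, 1)` of the
disk, which takes the point `a` of that geodesic to the origin `0 = g⁻¹(i)` of the disk. -/
def dilateToOrigin (a : ℝ) (S : Set (ℂ × ℝ)) : Set (ℂ × ℝ) :=
  (fun p : ℂ × ℝ => (((1 / cayleyIm a : ℝ) : ℂ) * cayley p.1, p.2)) '' S

/-! ### Tall rectangles (`0 < d < 1`) -/

/-- `d₁ = √(1 - d) / √(1 + d)`. -/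
def tallNeck (d : ℝ) : ℝ := √(1 - d) / √(1 + d)

/-- `λ_d(x)`, the height of the profile curve at the point `x ∈ [d₁, 1)`. -/
def tallProfile (d x : ℝ) : ℝ :=
  ∫ v in (tallNeck d)..x, 2 / √(d ^ 2 * (1 + v ^ 2) ^ 2 - (1 - v ^ 2) ^ 2)

/-- The image of the point `x ∈ (-1, 1)` under the hyperbolic dilation of the disk along the
geodesic from `-i` to `i` which takes `0` to `i y`. -/
def sweep (x y : ℝ) : ℂ :=
  ⟨(x - x * y ^ 2) / (x ^ 2 * y ^ 2 + 1), (x ^ 2 + 1) * y / (x ^ 2 * y ^ 2 + 1)⟩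

/-- The tall rectangle `Σ_d`, in the disk model. -/
def tallRectangle (d : ℝ) : Set (ℂ × ℝ) :=
  {p | ∃ x ∈ Ico (tallNeck d) 1, ∃ y ∈ Ioo (-1 : ℝ) 1,
    p.1 = sweep x y ∧ (p.2 = tallProfile d x ∨ p.2 = -tallProfile d x)}

/-- `Y_d`: the tall rectangle dilated so that `d₁` goes to the origin, in the half-plane model. -/
def dilatedTallRectangle (d : ℝ) : Set (ℂ × ℝ) := dilateToOrigin (tallNeck d) (tallRectangle d)

/-! ### Catenoids (`0 < κ`) -/

/-- The neck radius `r₀ = √(κ + 1) - √κ`. -/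
def catNeck (κ : ℝ) : ℝ := √(κ + 1) - √κ

/-- `t_κ(r)`, the height of the catenoid over the circle of (Euclidean) radius `r ∈ [r₀, 1)`. -/
def catProfile (κ r : ℝ) : ℝ :=
  ∫ u in (catNeck κ)..r, 2 / √(4 * κ * u ^ 2 - (1 - u ^ 2) ^ 2)

/-- The catenoid of revolution `C_κ`, in the disk model. -/
def catenoid (κ : ℝ) : Set (ℂ × ℝ) :=
  {p | ‖p.1‖ ∈ Ico (catNeck κ) 1 ∧ (p.2 = catProfile κ ‖p.1‖ ∨ p.2 = -catProfile κ ‖p.1‖)}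

/-- The catenoid dilated so that `r₀` goes to the origin, in the half-plane model. -/
def dilatedCatenoid (κ : ℝ) : Set (ℂ × ℝ) := dilateToOrigin (catNeck κ) (catenoid κ)

/-! ### The parabolic catenoid and convergence of surfaces -/

/-- The parabolic catenoid through the origin `(i, 0)`, in the half-plane model: the image of
`(x, t) ↦ (x + i cos t, t)`, `x ∈ ℝ`, `-π/2 < t < π/2`. -/
def parabolicCatenoid : Set (ℂ × ℝ) :=
  {p | p.2 ∈ Ioo (-(Real.pi / 2)) (Real.pi / 2) ∧ p.1.im = Real.cos p.2}

/-- Locally smooth convergence in the open set `Ω` (with multiplicity one) of surfaces `S d` to an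
embedded surface `S₀`, along the filter `l`: near every point of `Ω` (on or off `S₀`), the set `S₀`
is a regular zero set of a smooth function `F₀`, and `S d` is eventually the zero set of a smooth
function `F d`, where `F d → F₀` uniformly together with all derivatives. -/
def ConvergesSmoothly (Ω : Set (ℂ × ℝ)) (S : ℝ → Set (ℂ × ℝ)) (l : Filter ℝ)
    (S₀ : Set (ℂ × ℝ)) : Prop :=
  ∀ p ∈ Ω, ∃ V : Set (ℂ × ℝ), IsOpen V ∧ p ∈ V ∧ V ⊆ Ω ∧
    ∃ (F : ℝ → ℂ × ℝ → ℝ) (F₀ : ℂ × ℝ → ℝ),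
      (ContDiffOn ℝ ∞ F₀ V ∧ (∀ q ∈ V, q ∈ S₀ ↔ F₀ q = 0) ∧
        ∀ q ∈ V, F₀ q = 0 → fderiv ℝ F₀ q ≠ 0) ∧
      (∀ᶠ d in l, ContDiffOn ℝ ∞ (F d) V ∧ ∀ q ∈ V, q ∈ S d ↔ F d q = 0) ∧
      ∀ n : ℕ, TendstoUniformlyOn (fun d => iteratedFDeriv ℝ n (F d)) (iteratedFDeriv ℝ n F₀) l V

/-! ### Geometry of parametrized surfaces in the half-plane model -/

/-- The metric `(dx² + dy²) / y² + dt²` at the point `p`. -/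
def metric (p v w : ℂ × ℝ) : ℝ :=
  (v.1.re * w.1.re + v.1.im * w.1.im) / p.1.im ^ 2 + v.2 * w.2

/-- The Christoffel term `Γ_p(v, w)` of the Levi-Civita connection of `metric`:
`Γˣ = -(vˣwʸ + vʸwˣ)/y`, `Γʸ = (vˣwˣ - vʸwʸ)/y`, `Γᵗ = 0`. -/
def christoffel (p v w : ℂ × ℝ) : ℂ × ℝ :=
  (⟨-(v.1.re * w.1.im + v.1.im * w.1.re) / p.1.im, (v.1.re * w.1.re - v.1.im * w.1.im) / p.1.im⟩, 0)

/-- The Ricci curvature `Ric_p(v, v)` of `ℍ² × ℝ`: minus the squared norm of the horizontal part. -/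
def ricci (p v : ℂ × ℝ) : ℝ := -((v.1.re ^ 2 + v.1.im ^ 2) / p.1.im ^ 2)

/-- Partial derivatives of a function of two real variables. -/
def pd {E : Type*} [NormedAddCommGroup E] [NormedSpace ℝ E] (i : Fin 2) (f : ℝ → ℝ → E)
    (x y : ℝ) : E :=
  ![deriv (fun s => f s y) x, deriv (fun s => f x s) y] i

/-- The first fundamental form of `Φ`. -/
def firstForm (Φ : ℝ → ℝ → ℂ × ℝ) (x y : ℝ) : Matrix (Fin 2) (Fin 2) ℝ :=
  Matrix.of fun i j => metric (Φ x y) (pd i Φ x y) (pd j Φ x y)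

/-- `ν` is a unit normal of `Φ` at `(x, y)`. -/
def IsUnitNormal (Φ ν : ℝ → ℝ → ℂ × ℝ) (x y : ℝ) : Prop :=
  metric (Φ x y) (ν x y) (ν x y) = 1 ∧ ∀ i, metric (Φ x y) (ν x y) (pd i Φ x y) = 0

/-- The second fundamental form of `Φ` with respect to the unit normal `ν`: the normal component
of the ambient covariant derivative of `∂_j Φ` in the direction `∂_i Φ`. -/
def secondForm (Φ ν : ℝ → ℝ → ℂ × ℝ) (x y : ℝ) : Matrix (Fin 2) (Fin 2) ℝ :=
  Matrix.of fun i j => metric (Φ x y)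
    (pd i (pd j Φ) x y + christoffel (Φ x y) (pd i Φ x y) (pd j Φ x y)) (ν x y)

/-- `|A|²`, the squared norm of the second fundamental form (the trace of the squared shape
operator). -/
def normSqSecondForm (Φ ν : ℝ → ℝ → ℂ × ℝ) (x y : ℝ) : ℝ :=
  (((firstForm Φ x y)⁻¹ * secondForm Φ ν x y) ^ 2).trace

/-- The Laplace–Beltrami operator of the metric induced by `Φ`. -/
def laplaceBeltrami (Φ : ℝ → ℝ → ℂ × ℝ) (w : ℝ → ℝ → ℝ) (x y : ℝ) : ℝ :=
  1 / √(firstForm Φ x y).det *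
    ∑ i, pd i (fun a b => ∑ j, √(firstForm Φ a b).det * (firstForm Φ a b)⁻¹ i j * pd j w a b) x y

/-- The Jacobi operator `L = -(Δ + Ric(ν, ν) + |A|²)` of `Φ`, applied to `w`. -/
def jacobiOperator (Φ ν : ℝ → ℝ → ℂ × ℝ) (w : ℝ → ℝ → ℝ) (x y : ℝ) : ℝ :=
  -(laplaceBeltrami Φ w x y + (ricci (Φ x y) (ν x y) + normSqSecondForm Φ ν x y) * w x y)

/-! ### Jacobi fields of deformations -/

/-- The initial velocity, at `ε = 0⁺`, of a deformation `Φ ε`, `ε ≥ 0`, of `Φ 0`. -/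
def initialVelocity (Φ : ℝ → ℝ → ℝ → ℂ × ℝ) (x y : ℝ) : ℂ × ℝ :=
  derivWithin (fun ε => Φ ε x y) (Ici 0) 0

/-- The Jacobi field of a deformation: the normal component of its initial velocity. -/
def jacobiField (Φ : ℝ → ℝ → ℝ → ℂ × ℝ) (ν : ℝ → ℝ → ℂ × ℝ) (x y : ℝ) : ℝ :=
  metric (Φ 0 x y) (ν x y) (initialVelocity Φ x y)

/-- The parametrization `(x, y) ↦ (x + i y, t)` of the top half of a bigraph `S` over a region of
the upper half-plane; here `t` is the largest height of the points of `S` above `x + i y`. -/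
def topHalf (S : Set (ℂ × ℝ)) (x y : ℝ) : ℂ × ℝ :=
  (⟨x, y⟩, sSup {t : ℝ | ((⟨x, y⟩ : ℂ), t) ∈ S})

/-- Deformation of the parabolic catenoid into tall rectangles, with parameter `ε = d²`. -/
def tallDeformation (ε : ℝ) : ℝ → ℝ → ℂ × ℝ :=
  topHalf (if 0 < ε then dilatedTallRectangle √ε else parabolicCatenoid)

/-- Deformation of the parabolic catenoid into catenoids, with parameter `κ`. -/
def catDeformation (κ : ℝ) : ℝ → ℝ → ℂ × ℝ :=
  topHalf (if 0 < κ then dilatedCatenoid κ else parabolicCatenoid)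

/-- The Gauss map `ν = (0, -y², -√(1 - y²))` of the top half `(x, y, arccos y)` of the parabolic
catenoid. -/
def gaussMap (_x y : ℝ) : ℂ × ℝ := (⟨0, -y ^ 2⟩, -√(1 - y ^ 2))

end HypProd

end

/-! Both families are governed by one elliptic integral, E(e, v) = ∫ u in v..1, 1 / (√(1 - u²) √(1 -
e u²)). Let ρ be the distance to the axis geodesic (tall rectangles) or to the centre of rotation
(catenoids). The substitution v = 1 / (d cosh ρ) turns the tall profile into E(d², v)
(`tallProfile_eq`). With e = κ / (κ + 1), the catenoid has the neck of the tall rectangle with d² =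
e, and its height is √(1 - e) E(e, v) (`catProfile_eq`). After the dilation, v is an explicit
function of e, x, y, smooth at e = 0 with value y there: axis and centre have escaped to infinity
and only horocycles remain. As E(0, y) = arccos y, the limit is the parabolic catenoid.

For smooth convergence across the neck, u = 1 - w² removes the endpoint singularity: E = √(1 - v)
M(e, 1 - v) with M smooth and positive, also beyond v = 1. The equation t² - (1 - v) M² = 0 thus
describes both sheets at once and is smooth jointly in d and the point, up to d = 0; compactness
then gives uniform convergence of all derivatives of its slices.

For the Jacobi fields, `hasDerivAt_ellHeight_comp` is the first-order expansion of E(e, v(e)) at e =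
0. The velocity is vertical, so only its product with the vertical part of ν remains. Equidistant
curves and circles bend to opposite sides of the horocycles, which gives the x² terms opposite
signs; the factor √(1 - e) reverses the arccos term. The Jacobi equation is a direct computation,
with potential Ric + |A|² = y². -/

/-! ### Smooth dependence on parameters -/

theorem hasFDerivAt_integral_of_contDiffOn {E F : Type} [NormedAddCommGroup E] [NormedSpace ℝ E]
    [ProperSpace E] [NormedAddCommGroup F] [NormedSpace ℝ F] {U : Set E} (hU : IsOpen U)
    {W : Set (E × ℝ)} (hW : IsOpen W) (hUW : U ×ˢ Icc (0 : ℝ) 1 ⊆ W) {f : E × ℝ → F}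
    (hf : ContDiffOn ℝ 1 f W) {x : E} (hx : x ∈ U) :
    HasFDerivAt (fun x => ∫ s in (0 : ℝ)..1, f (x, s))
      (∫ s in (0 : ℝ)..1, (fderiv ℝ f (x, s)).comp (ContinuousLinearMap.inl ℝ E ℝ)) x := by
  obtain ⟨r, hr, hrU⟩ := Metric.nhds_basis_closedBall.mem_iff.1 (hU.mem_nhds hx)
  have hI : uIoc (0 : ℝ) 1 ⊆ Icc 0 1 := by
    rw [uIoc_of_le zero_le_one]; exact Ioc_subset_Icc_self
  have hslice : ∀ y ∈ U, MapsTo (fun s : ℝ => (y, s)) (Icc 0 1) W := fun y hy s hs => hUW ⟨hy, hs⟩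
  have hcf : ∀ y ∈ U, ContinuousOn (fun s => f (y, s)) (Icc 0 1) := fun y hy =>
    hf.continuousOn.comp (by fun_prop) (hslice y hy)
  have hd : ContinuousOn
      (fun p => (fderiv ℝ f p).comp (ContinuousLinearMap.inl ℝ E ℝ)) W :=
    (hf.continuousOn_fderiv_of_isOpen hW le_rfl).clm_comp continuousOn_const
  -- The dominating function is a constant: the parameter derivative is continuous on the compact
  -- product of a closed ball with [0, 1].
  have hK := (isCompact_closedBall x r).prod (isCompact_Icc (a := (0 : ℝ)) (b := 1))
  obtain ⟨C, hC⟩ := hK.exists_bound_of_continuousOn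
    (hd.mono fun p hp => hUW ⟨hrU hp.1, hp.2⟩)
  refine intervalIntegral.hasFDerivAt_integral_of_dominated_of_fderiv_le
    (F := fun x s => f (x, s)) (bound := fun _ => C)
    (F' := fun x s => (fderiv ℝ f (x, s)).comp (ContinuousLinearMap.inl ℝ E ℝ))
    (Metric.closedBall_mem_nhds x hr) ?_ ?_ ?_ ?_ ?_ ?_
  · filter_upwards [hU.mem_nhds hx] with y hy
    exact ((hcf y hy).aestronglyMeasurable measurableSet_Icc).mono_set hI
  · exact ContinuousOn.intervalIntegrable (by rw [uIcc_of_le zero_le_one]; exact hcf x hx)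
  · exact ((hd.comp (by fun_prop) (hslice x hx)).aestronglyMeasurable
      measurableSet_Icc).mono_set hI
  · exact .of_forall fun s hs y hy => hC (y, s) ⟨hy, hI hs⟩
  · exact intervalIntegrable_const
  · refine .of_forall fun s hs y hy => ?_
    have hp := hslice y (hrU hy) (hI hs)
    have h1 := ((hf.contDiffAt (hW.mem_nhds hp)).differentiableAt one_ne_zero).hasFDerivAt
    exact h1.comp y (hasFDerivAt_prodMk_left y s)

/-- Integrals of smooth functions over `[0, 1]` depend smoothly on parameters. -/
theorem contDiffOn_integral_param {E : Type} [NormedAddCommGroup E] [NormedSpace ℝ E]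
    [ProperSpace E] {U : Set E} (hU : IsOpen U)
    {W : Set (E × ℝ)} (hW : IsOpen W) (hUW : U ×ˢ Icc (0 : ℝ) 1 ⊆ W) (n : ℕ)
    {F : Type} [NormedAddCommGroup F] [NormedSpace ℝ F] {f : E × ℝ → F}
    (hf : ContDiffOn ℝ (n + 1) f W) :
    ContDiffOn ℝ n (fun x => ∫ s in (0 : ℝ)..1, f (x, s)) U := by
  -- The target varies because the induction is applied to the derivative, with values in `E →L[ℝ]
  -- F`. One order of smoothness is lost, which is harmless for `∞`.
  induction n generalizing F with
  | zero =>
    have hf1 : ContDiffOn ℝ 1 f W := by simpa using hf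
    refine contDiffOn_zero.2 fun x hx => ?_
    exact (hasFDerivAt_integral_of_contDiffOn hU hW hUW hf1 hx).continuousAt.continuousWithinAt
  | succ n ih =>
    have hf1 : ContDiffOn ℝ 1 f W := hf.of_le (by norm_cast; omega)
    have key := fun x hx => hasFDerivAt_integral_of_contDiffOn hU hW hUW hf1 (x := x) hx
    push_cast
    rw [contDiffOn_succ_iff_fderiv_of_isOpen hU]
    refine ⟨fun x hx => (key x hx).differentiableAt.differentiableWithinAt, by simp, ?_⟩
    refine ContDiffOn.congr (ih (f := fun p => (fderiv ℝ f p).comp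
      (ContinuousLinearMap.inl ℝ E ℝ)) ?_) fun x hx => (key x hx).fderiv
    refine ContDiffOn.clm_comp (hf.fderiv_of_isOpen hW (by push_cast; rfl)) contDiffOn_const

/-- The slices of a jointly smooth function converge, locally uniformly with all derivatives. -/
theorem tendstoUniformlyOn_iteratedFDeriv_slice {E : Type} [NormedAddCommGroup E]
    [NormedSpace ℝ E] {W : Set (ℝ × E)} (hW : IsOpen W) {G : ℝ × E → ℝ}
    (hG : ContDiffOn ℝ ∞ G W) {K : Set E} (hK : IsCompact K) {a : ℝ}
    (haK : ∀ q ∈ K, (a, q) ∈ W) (n : ℕ) :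
    TendstoUniformlyOn (fun d => iteratedFDeriv ℝ n (fun q => G (d, q)))
      (iteratedFDeriv ℝ n (fun q => G (a, q))) (𝓝 a) K := by
  have hslice : ∀ d q, (d, q) ∈ W → iteratedFDeriv ℝ n (fun q => G (d, q)) q =
      (iteratedFDeriv ℝ n G (d, q)).compContinuousLinearMap
        fun _ => ContinuousLinearMap.inr ℝ ℝ E := by
    intro d q hq
    -- A slice is a translate of `G` composed with the linear map `inr`, so its iterated derivatives
    -- are restrictions of those of `G`.
    have h1 : (fun q => G (d, q)) =
        (fun p => G ((d, 0) + p)) ∘ ContinuousLinearMap.inr ℝ ℝ E := by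
      ext q; simp
    have hopen : IsOpen ((fun p : ℝ × E => (d, 0) + p) ⁻¹' W) := hW.preimage (by fun_prop)
    have hopen' : IsOpen (ContinuousLinearMap.inr ℝ ℝ E ⁻¹' ((fun p : ℝ × E => (d, 0) + p) ⁻¹' W)) :=
      hopen.preimage (by fun_prop)
    have hq' : ContinuousLinearMap.inr ℝ ℝ E q ∈ (fun p : ℝ × E => (d, 0) + p) ⁻¹' W := by
      simpa using hq
    have hs : ContDiffOn ℝ ∞ (fun p => G ((d, 0) + p)) ((fun p : ℝ × E => (d, 0) + p) ⁻¹' W) :=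
      hG.comp (by fun_prop) (mapsTo_preimage _ _)
    have h2 := (ContinuousLinearMap.inr ℝ ℝ E).iteratedFDerivWithin_comp_right hs
      hopen.uniqueDiffOn hopen'.uniqueDiffOn hq' (i := n) (by exact_mod_cast le_top)
    rw [iteratedFDerivWithin_of_isOpen n hopen' hq', iteratedFDerivWithin_of_isOpen n hopen hq',
      iteratedFDeriv_comp_add_left] at h2
    rw [h1, h2]
    simp
  have hcont : ContinuousOn (fun p => iteratedFDeriv ℝ n G p) W := by
    refine (hG.continuousOn_iteratedFDerivWithin (m := n) (by exact_mod_cast le_top)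
      hW.uniqueDiffOn).congr fun p hp => (iteratedFDerivWithin_of_isOpen n hW hp).symm
  have hcont2 : ContinuousOn (fun p => (iteratedFDeriv ℝ n G p).compContinuousLinearMap
        fun _ => ContinuousLinearMap.inr ℝ ℝ E) W :=
    (ContinuousMultilinearMap.compContinuousLinearMapL (𝕜 := ℝ) (F := ℝ)
      (fun _ : Fin n => ContinuousLinearMap.inr ℝ ℝ E)).continuous.comp_continuousOn hcont
  rw [← tendstoLocallyUniformlyOn_iff_tendstoUniformlyOn_of_compact hK]
  intro u hu q hq
  have hW' := hW.mem_nhds (haK q hq)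
  have hat : ContinuousAt (fun p : ℝ × E => iteratedFDeriv ℝ n (fun q => G (p.1, q)) p.2) (a, q) :=
    (hcont2.continuousAt hW').congr (by
      filter_upwards [hW'] with p hp
      exact (hslice p.1 p.2 hp).symm)
  -- By joint continuity, the values at (a, y) and (d, y) are both close to the one at (a, q); the
  -- triangle inequality compares them.
  obtain ⟨v, hv, hvs, hvu⟩ := comp_symm_mem_uniformity_sets hu
  have hev := hat.eventually (UniformSpace.ball_mem_nhds _ hv)
  rw [nhds_prod_eq] at hev
  obtain ⟨A, hA, B, hB, hAB⟩ := eventually_prod_iff.1 hev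
  refine ⟨{y | B y}, mem_nhdsWithin_of_mem_nhds hB, ?_⟩
  filter_upwards [hA] with d hd y hy
  refine hvu ⟨iteratedFDeriv ℝ n (fun q => G (a, q)) q, ?_, hAB hd hy⟩
  exact hvs.symm _ _ (hAB hA.self_of_nhds hy)

/-! ### The elliptic integral common to both families -/

noncomputable section

namespace HypProd

/-- The smooth factor of the elliptic integral `ellHeight`. -/
def ellMean (e m : ℝ) : ℝ :=
  ∫ s in (0 : ℝ)..1, 2 / (√(2 - s ^ 2 * m) * √(1 - e * (1 - s ^ 2 * m) ^ 2))

/-- The elliptic integral `∫ u in v..1, 1 / (√(1 - u²) √(1 - e u²))`, written with the integrand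
regularized at `u = 1`. -/
def ellHeight (e v : ℝ) : ℝ := √(1 - v) * ellMean e (1 - v)

/-- A domain on which `ellMean` is smooth. -/
def ellDomain : Set (ℝ × ℝ) := {p | p.2 < 2 ∧ |p.1| * (1 + |p.2|) ^ 2 < 1}

theorem isOpen_ellDomain : IsOpen ellDomain := by
  have h1 : IsOpen {p : ℝ × ℝ | p.2 < 2} := isOpen_lt (by fun_prop) (by fun_prop)
  have h2 : IsOpen {p : ℝ × ℝ | |p.1| * (1 + |p.2|) ^ 2 < 1} :=
    isOpen_lt (by fun_prop) (by fun_prop)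
  exact h1.and h2

/-- The bound |1 - s² m| ≤ 1 + |m| explains the shape of the domain. With m = 1 - v, negative m is
allowed, so smoothness reaches past the neck v = 1. -/
theorem ellDomain_bounds {e m s : ℝ} (h : (e, m) ∈ ellDomain) (hs : s ∈ Icc (0 : ℝ) 1) :
    0 < 2 - s ^ 2 * m ∧ 0 < 1 - e * (1 - s ^ 2 * m) ^ 2 := by
  obtain ⟨h1, h2⟩ := h
  simp only at h1 h2
  have hs0 := sq_nonneg s
  have hs1 : s ^ 2 ≤ 1 := pow_le_one₀ hs.1 hs.2
  constructor
  · rcases le_total m 0 with hm | hm <;> nlinarith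
  · have hb : |1 - s ^ 2 * m| ≤ 1 + |m| := by
      calc |1 - s ^ 2 * m| ≤ |1| + |s ^ 2 * m| := abs_sub _ _
        _ ≤ 1 + |m| := by
          rw [abs_mul, abs_of_nonneg hs0, abs_one]
          nlinarith [abs_nonneg m]
    have hc : (1 - s ^ 2 * m) ^ 2 ≤ (1 + |m|) ^ 2 := by
      rw [← sq_abs]; exact pow_le_pow_left₀ (abs_nonneg _) hb 2
    nlinarith [le_abs_self e, abs_nonneg e, sq_nonneg (1 - s ^ 2 * m)]

theorem mem_ellDomain {e m : ℝ} (he : |e| < 1 / 4) (h0 : -1 ≤ m) (h1 : m ≤ 1) :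
    (e, m) ∈ ellDomain := by
  refine ⟨by simp only; linarith, ?_⟩
  have hm : |m| ≤ 1 := abs_le.2 ⟨h0, h1⟩
  have : (1 + |m|) ^ 2 ≤ 4 := by nlinarith [abs_nonneg m]
  simp only
  nlinarith [abs_nonneg e]

theorem contDiffAt_ellMean_integrand {e m s : ℝ} (h1 : 0 < 2 - s ^ 2 * m)
    (h2 : 0 < 1 - e * (1 - s ^ 2 * m) ^ 2) (n : WithTop ℕ∞) :
    ContDiffAt ℝ n (fun p : (ℝ × ℝ) × ℝ =>
      2 / (√(2 - p.2 ^ 2 * p.1.2) * √(1 - p.1.1 * (1 - p.2 ^ 2 * p.1.2) ^ 2))) ((e, m), s) := by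
  refine contDiffAt_const.div (ContDiffAt.mul (ContDiffAt.sqrt (by fun_prop) h1.ne')
    (ContDiffAt.sqrt (by fun_prop) h2.ne')) ?_
  have := Real.sqrt_pos.2 h1
  have := Real.sqrt_pos.2 h2
  positivity

theorem contDiffOn_ellMean :
    ContDiffOn ℝ ∞ (fun p : ℝ × ℝ => ellMean p.1 p.2) ellDomain := by
  refine contDiffOn_infty.2 fun n => ?_
  set W : Set ((ℝ × ℝ) × ℝ) :=
    {p | 0 < 2 - p.2 ^ 2 * p.1.2 ∧ 0 < 1 - p.1.1 * (1 - p.2 ^ 2 * p.1.2) ^ 2}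
  have hW1 : IsOpen {p : (ℝ × ℝ) × ℝ | 0 < 2 - p.2 ^ 2 * p.1.2} :=
    isOpen_lt (by fun_prop) (by fun_prop)
  have hW2 : IsOpen {p : (ℝ × ℝ) × ℝ | 0 < 1 - p.1.1 * (1 - p.2 ^ 2 * p.1.2) ^ 2} :=
    isOpen_lt (by fun_prop) (by fun_prop)
  have hW : IsOpen W := hW1.and hW2
  refine contDiffOn_integral_param isOpen_ellDomain hW
    (fun p hp => ellDomain_bounds hp.1 hp.2) n (f := fun p : (ℝ × ℝ) × ℝ =>
      2 / (√(2 - p.2 ^ 2 * p.1.2) * √(1 - p.1.1 * (1 - p.2 ^ 2 * p.1.2) ^ 2))) ?_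
  exact fun p hp => (contDiffAt_ellMean_integrand hp.1 hp.2 _).contDiffWithinAt

theorem continuousOn_ellMean_integrand {e m : ℝ} (h : (e, m) ∈ ellDomain) :
    ContinuousOn (fun s => 2 / (√(2 - s ^ 2 * m) * √(1 - e * (1 - s ^ 2 * m) ^ 2)))
      (Icc (0 : ℝ) 1) := fun s hs => by
  obtain ⟨h1, h2⟩ := ellDomain_bounds h hs
  have := (contDiffAt_ellMean_integrand h1 h2 0).continuousAt
  exact (ContinuousAt.comp (f := fun s : ℝ => ((e, m), s)) this
    (by fun_prop)).continuousWithinAt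

theorem ellMean_pos {e m : ℝ} (h : (e, m) ∈ ellDomain) : 0 < ellMean e m := by
  refine intervalIntegral.intervalIntegral_pos_of_pos_on ?_ (fun s hs => ?_) one_pos
  · refine ContinuousOn.intervalIntegrable ?_
    rw [uIcc_of_le zero_le_one]
    exact continuousOn_ellMean_integrand h
  · obtain ⟨h1, h2⟩ := ellDomain_bounds h (Ioo_subset_Icc_self hs)
    have := Real.sqrt_pos.2 h1
    have := Real.sqrt_pos.2 h2
    positivity

/-- Rescaling by √(1 - v). The new variable is the square root of 1 minus the variable of the
original elliptic integral. -/
theorem ellHeight_eq_integral (e : ℝ) {v : ℝ} (hv : v ≤ 1) :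
    ellHeight e v =
      ∫ u in (0 : ℝ)..√(1 - v), 2 / (√(2 - u ^ 2) * √(1 - e * (1 - u ^ 2) ^ 2)) := by
  have := intervalIntegral.mul_integral_comp_mul_right (a := 0) (b := 1)
    (f := fun u : ℝ => 2 / (√(2 - u ^ 2) * √(1 - e * (1 - u ^ 2) ^ 2))) √(1 - v)
  simp only [zero_mul, one_mul, mul_pow, Real.sq_sqrt (sub_nonneg.2 hv)] at this
  exact this

theorem ellHeight_one (e : ℝ) : ellHeight e 1 = 0 := by simp [ellHeight]

theorem ellHeight_pos {e v : ℝ} (he : |e| < 1 / 4) (h0 : 0 ≤ v) (h1 : v < 1) :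
    0 < ellHeight e v :=
  mul_pos (Real.sqrt_pos.2 (by linarith))
    (ellMean_pos (mem_ellDomain he (by linarith) (by linarith)))

theorem continuousOn_ellHeight {e : ℝ} (he : |e| < 1 / 4) :
    ContinuousOn (ellHeight e) (Icc 0 1) := by
  refine ContinuousOn.mul (by fun_prop) ?_
  exact contDiffOn_ellMean.continuousOn.comp (f := fun v : ℝ => (e, 1 - v)) (by fun_prop)
    fun v hv => mem_ellDomain he (by linarith [hv.2]) (by linarith [hv.1])

theorem hasDerivAt_ellHeight {e v : ℝ} (he : |e| < 1 / 4) (h0 : 0 < v) (h1 : v < 1) :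
    HasDerivAt (ellHeight e) (-(1 / (√(1 - v ^ 2) * √(1 - e * v ^ 2)))) v := by
  set g : ℝ → ℝ := fun u => 2 / (√(2 - u ^ 2) * √(1 - e * (1 - u ^ 2) ^ 2))
  have hev : (1 - e * v ^ 2) > 0 := by
    nlinarith [le_abs_self e, mul_nonneg (abs_nonneg e) (sq_nonneg v)]
  have hs : 0 < √(1 - v) := Real.sqrt_pos.2 (by linarith)
  have hs2 : √(1 - v) ^ 2 = 1 - v := Real.sq_sqrt (by linarith)
  have hcont : ∀ u ∈ Icc 0 √(1 - v), ContinuousAt g u := fun u hu => by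
    have hu2 : u ^ 2 ≤ 1 - v := by rw [← hs2]; exact pow_le_pow_left₀ hu.1 hu.2 2
    have h3 : 0 < √(2 - u ^ 2) := Real.sqrt_pos.2 (by linarith)
    have h4 : 0 < √(1 - e * (1 - u ^ 2) ^ 2) := Real.sqrt_pos.2 (by
      have : (1 - u ^ 2) ^ 2 ≤ 1 := pow_le_one₀ (by linarith) (by nlinarith)
      nlinarith [le_abs_self e, sq_nonneg (1 - u ^ 2), abs_nonneg e])
    exact ContinuousAt.div (by fun_prop) (by fun_prop) (by positivity)
  have hmeas : StronglyMeasurableAtFilter g (𝓝 √(1 - v)) :=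
    (Measurable.stronglyMeasurable (by fun_prop)).stronglyMeasurableAtFilter
  have hint : HasDerivAt (fun s => ∫ u in (0 : ℝ)..s, g u) (g √(1 - v)) √(1 - v) :=
    intervalIntegral.integral_hasDerivAt_right
      (ContinuousOn.intervalIntegrable (by
        rw [uIcc_of_le hs.le]; exact fun u hu => (hcont u hu).continuousWithinAt)) hmeas
      (hcont _ (right_mem_Icc.2 hs.le))
  have hsq : HasDerivAt (fun v => √(1 - v)) (-1 / (2 * √(1 - v))) v :=
    HasDerivAt.sqrt (by simpa using (hasDerivAt_id v).const_sub 1) (by linarith)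
  refine ((hint.comp v hsq).congr_of_eventuallyEq (f₁ := ellHeight e) (by
    filter_upwards [Iio_mem_nhds h1] with w hw
    exact ellHeight_eq_integral e hw.le)).congr_deriv ?_
  have h5 : √(1 - v ^ 2) = √(1 - v) * √(1 + v) := by
    rw [← Real.sqrt_mul (by linarith)]; ring_nf
  have h6 : 2 - (1 - v) = 1 + v := by ring
  have h7 : 1 - (1 - v) = v := by ring
  have h8 : 0 < √(1 + v) := Real.sqrt_pos.2 (by linarith)
  have h9 := Real.sqrt_pos.2 hev
  simp only [g, hs2, h6, h7, h5]
  field_simp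

theorem sqrt_one_sub_sq_sub {s : ℝ} (hs : 0 ≤ s) : √(1 - (1 - s ^ 2) ^ 2) = s * √(2 - s ^ 2) := by
  rw [show 1 - (1 - s ^ 2) ^ 2 = s ^ 2 * (2 - s ^ 2) by ring, Real.sqrt_mul (sq_nonneg s),
    Real.sqrt_sq hs]

theorem hasDerivAt_arccos_one_sub_sq {s : ℝ} (h0 : 0 < s) (h1 : s < 1) :
    HasDerivAt (fun s => Real.arccos (1 - s ^ 2)) (2 / √(2 - s ^ 2)) s := by
  have h2 : HasDerivAt (fun s : ℝ => 1 - s ^ 2) (-(2 * s)) s := by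
    simpa using (hasDerivAt_pow 2 s).const_sub 1
  have h3 := (Real.hasDerivAt_arccos (x := 1 - s ^ 2) (by nlinarith) (by nlinarith)).comp s h2
  refine h3.congr_deriv ?_
  have : 0 < √(2 - s ^ 2) := Real.sqrt_pos.2 (by nlinarith)
  rw [sqrt_one_sub_sq_sub h0.le]
  field_simp

theorem ellHeight_zero {v : ℝ} (h0 : 0 < v) (h1 : v ≤ 1) : ellHeight 0 v = Real.arccos v := by
  have hs2 : √(1 - v) ^ 2 = 1 - v := Real.sq_sqrt (by linarith)
  have hs1 : √(1 - v) < 1 := by rw [Real.sqrt_lt' one_pos]; linarith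
  rw [ellHeight_eq_integral 0 h1, intervalIntegral.integral_eq_sub_of_hasDerivAt_of_le
    (f := fun s => Real.arccos (1 - s ^ 2)) (Real.sqrt_nonneg _)]
  · simp [hs2]
  · exact (Real.continuous_arccos.comp (by fun_prop)).continuousOn
  · intro s hs
    simpa using hasDerivAt_arccos_one_sub_sq hs.1 (hs.2.trans hs1)
  · refine ContinuousOn.intervalIntegrable fun u hu => ?_
    rw [uIcc_of_le (Real.sqrt_nonneg _)] at hu
    have : 0 < √(2 - u ^ 2) := Real.sqrt_pos.2 (by nlinarith [hu.1, hu.2])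
    refine ContinuousAt.continuousWithinAt (ContinuousAt.div (by fun_prop) (by fun_prop) ?_)
    simpa using this.ne'

/-- In the original variable this is ½ ∫ u² / √(1 - u²) over [v, 1], the coefficient of e in the
expansion of the elliptic integral, since (1 - e u²)^(-1/2) = 1 + e u² / 2 + ⋯. -/
theorem integral_sq_div_sqrt {v : ℝ} (h0 : 0 < v) (h1 : v ≤ 1) :
    ∫ u in (0 : ℝ)..√(1 - v), (1 - u ^ 2) ^ 2 / √(2 - u ^ 2) =
      1 / 4 * (Real.arccos v + v * √(1 - v ^ 2)) := by
  have hs2 : √(1 - v) ^ 2 = 1 - v := Real.sq_sqrt (by linarith)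
  have hs1 : √(1 - v) < 1 := by rw [Real.sqrt_lt' one_pos]; linarith
  rw [intervalIntegral.integral_eq_sub_of_hasDerivAt_of_le
    (f := fun s => 1 / 4 * (Real.arccos (1 - s ^ 2) + (1 - s ^ 2) * (s * √(2 - s ^ 2))))
    (Real.sqrt_nonneg _)]
  · rw [hs2, show v * √(1 - v ^ 2) = (1 - √(1 - v) ^ 2) * √(1 - (1 - √(1 - v) ^ 2) ^ 2) by
      rw [hs2]; ring_nf, sqrt_one_sub_sq_sub (Real.sqrt_nonneg _), hs2]
    simp
  · refine Continuous.continuousOn (continuous_const.mul (Continuous.add ?_ (by fun_prop)))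
    exact Real.continuous_arccos.comp (by fun_prop)
  · intro s hs
    have hlt := hs.2.trans hs1
    have hp : 0 < 2 - s ^ 2 := by nlinarith [hs.1]
    have hq := Real.sqrt_pos.2 hp
    have h2 : HasDerivAt (fun s : ℝ => 1 - s ^ 2) (-(2 * s)) s := by
      simpa using (hasDerivAt_pow 2 s).const_sub 1
    have h3 : HasDerivAt (fun s : ℝ => √(2 - s ^ 2)) (-(2 * s) / (2 * √(2 - s ^ 2))) s :=
      HasDerivAt.sqrt (by simpa using (hasDerivAt_pow 2 s).const_sub 2) hp.ne'
    refine (((hasDerivAt_arccos_one_sub_sq hs.1 hlt).add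
      (h2.mul ((hasDerivAt_id s).mul h3))).const_mul (1 / 4 : ℝ)).congr_deriv ?_
    simp only [id, Pi.mul_apply]
    field_simp
    rw [Real.sq_sqrt hp.le]
    ring
  · refine ContinuousOn.intervalIntegrable fun u hu => ?_
    rw [uIcc_of_le (Real.sqrt_nonneg _)] at hu
    have : 0 < √(2 - u ^ 2) := Real.sqrt_pos.2 (by nlinarith [hu.1, hu.2])
    exact ContinuousAt.continuousWithinAt (ContinuousAt.div (by fun_prop) (by fun_prop) this.ne')

theorem hasDerivAt_ellHeight_left {v : ℝ} (h0 : 0 < v) (h1 : v ≤ 1) :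
    HasDerivAt (fun e => ellHeight e v) (1 / 4 * (Real.arccos v + v * √(1 - v ^ 2))) 0 := by
  set W : Set (ℝ × ℝ) :=
    {p | 0 < 2 - p.2 ^ 2 * (1 - v) ∧ 0 < 1 - p.1 * (1 - p.2 ^ 2 * (1 - v)) ^ 2}
  have hW1 : IsOpen {p : ℝ × ℝ | 0 < 2 - p.2 ^ 2 * (1 - v)} :=
    isOpen_lt (by fun_prop) (by fun_prop)
  have hW2 : IsOpen {p : ℝ × ℝ | 0 < 1 - p.1 * (1 - p.2 ^ 2 * (1 - v)) ^ 2} :=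
    isOpen_lt (by fun_prop) (by fun_prop)
  have hW : IsOpen W := hW1.and hW2
  set U : Set ℝ := {e | (e, 1 - v) ∈ ellDomain}
  have hU : IsOpen U := isOpen_ellDomain.preimage (by fun_prop)
  have h0U : (0 : ℝ) ∈ U := mem_ellDomain (by simp) (by linarith) (by linarith)
  set f : ℝ × ℝ → ℝ := fun p =>
    2 / (√(2 - p.2 ^ 2 * (1 - v)) * √(1 - p.1 * (1 - p.2 ^ 2 * (1 - v)) ^ 2))
  have hf : ContDiffOn ℝ 1 f W := fun p hp =>
    ((contDiffAt_ellMean_integrand hp.1 hp.2 1).comp (f := fun p : ℝ × ℝ => ((p.1, 1 - v), p.2))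
      p (by fun_prop)).contDiffWithinAt
  have hUW : U ×ˢ Icc (0 : ℝ) 1 ⊆ W := fun p hp => ellDomain_bounds hp.1 hp.2
  have key := (hasFDerivAt_integral_of_contDiffOn hU hW hUW hf h0U).hasDerivAt.const_mul √(1 - v)
  refine key.congr_deriv (Eq.symm ?_)
  rw [← integral_sq_div_sqrt h0 h1]
  have hdf : ContinuousOn (fun s : ℝ =>
      (fderiv ℝ f (0, s)).comp (ContinuousLinearMap.inl ℝ ℝ ℝ)) (uIcc 0 1) := by
    rw [uIcc_of_le zero_le_one]
    exact ((hf.continuousOn_fderiv_of_isOpen hW le_rfl).clm_comp continuousOn_const).comp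
      (by fun_prop) fun s hs => hUW ⟨h0U, hs⟩
  rw [ContinuousLinearMap.intervalIntegral_apply hdf.intervalIntegrable]
  have := intervalIntegral.mul_integral_comp_mul_right (a := 0) (b := 1)
    (f := fun u : ℝ => (1 - u ^ 2) ^ 2 / √(2 - u ^ 2)) √(1 - v)
  simp only [zero_mul, one_mul, mul_pow, Real.sq_sqrt (sub_nonneg.2 h1)] at this
  rw [← this]
  congr 1
  refine intervalIntegral.integral_congr fun s hs => ?_
  rw [uIcc_of_le zero_le_one] at hs
  have hp := hUW (show ((0 : ℝ), s) ∈ U ×ˢ Icc (0 : ℝ) 1 from ⟨h0U, hs⟩)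
  have hd0 : HasFDerivAt f (fderiv ℝ f (0, s)) (0, s) :=
    ((hf.contDiffAt (hW.mem_nhds hp)).differentiableAt one_ne_zero).hasFDerivAt
  have hd := hd0.comp (0 : ℝ) (hasFDerivAt_prodMk_left (𝕜 := ℝ) (0 : ℝ) s)
  have hsq := Real.sqrt_pos.2 hp.1
  have hlin : HasDerivAt (fun e : ℝ => 1 - e * (1 - s ^ 2 * (1 - v)) ^ 2)
      (-(1 - s ^ 2 * (1 - v)) ^ 2) 0 := by
    simpa using ((hasDerivAt_id (0 : ℝ)).mul_const ((1 - s ^ 2 * (1 - v)) ^ 2)).const_sub 1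
  have hd' : HasDerivAt (fun e : ℝ => f (e, s))
      ((1 - s ^ 2 * (1 - v)) ^ 2 / √(2 - s ^ 2 * (1 - v))) 0 := by
    have h3 := ((hlin.sqrt (by simp)).const_mul √(2 - s ^ 2 * (1 - v)))
    refine ((hasDerivAt_const (0 : ℝ) (2 : ℝ)).div h3 (by simpa using hsq.ne')).congr_deriv ?_
    simp only [zero_mul, sub_zero, Real.sqrt_one]
    field_simp
    ring
  exact hd'.unique hd.hasDerivAt

theorem contDiffAt_ellHeight {e v : ℝ} (he : |e| < 1 / 4) (h0 : 0 ≤ v) (h1 : v < 1) :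
    ContDiffAt ℝ ∞ (fun p : ℝ × ℝ => ellHeight p.1 p.2) (e, v) := by
  refine ContDiffAt.mul (ContDiffAt.sqrt (by fun_prop) (by simp only; linarith)) ?_
  exact (contDiffOn_ellMean.contDiffAt (isOpen_ellDomain.mem_nhds
    (mem_ellDomain he (by linarith) (by linarith)))).comp
    (f := fun p : ℝ × ℝ => (p.1, 1 - p.2)) (e, v) (by fun_prop)

/-- Chain rule at e = 0: the first term is the explicit dependence on e, the second the motion of
the lower limit. -/
theorem hasDerivAt_ellHeight_comp {V : ℝ → ℝ} {v V' : ℝ} (hv : V 0 = v) (h0 : 0 < v) (h1 : v < 1)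
    (hV : HasDerivAt V V' 0) :
    HasDerivAt (fun e => ellHeight e (V e))
      (1 / 4 * (Real.arccos v + v * √(1 - v ^ 2)) - V' / √(1 - v ^ 2)) 0 := by
  have hd := ((contDiffAt_ellHeight (e := 0) (by simp) h0.le h1).differentiableAt
    (by simp)).hasFDerivAt
  set L := fderiv ℝ (fun p : ℝ × ℝ => ellHeight p.1 p.2) (0, v)
  have e1 : L (1, 0) = 1 / 4 * (Real.arccos v + v * √(1 - v ^ 2)) := by
    have := (hd.comp (0 : ℝ) (hasFDerivAt_prodMk_left (0 : ℝ) v)).hasDerivAt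
    simpa using this.unique (hasDerivAt_ellHeight_left h0 h1.le)
  have e2 : L (0, 1) = -(1 / √(1 - v ^ 2)) := by
    have := (hd.comp v (hasFDerivAt_prodMk_right (0 : ℝ) v)).hasDerivAt
    simpa using this.unique (hasDerivAt_ellHeight (e := 0) (by simp) h0 h1)
  have hc := HasFDerivAt.comp_hasDerivAt_of_eq (0 : ℝ) hd ((hasDerivAt_id (0 : ℝ)).prodMk hV)
    (by simp [hv])
  refine hc.congr_deriv ?_
  rw [show ((1 : ℝ), V') = (1, 0) + V' • (0, 1) by simp, map_add, map_smul, e1, e2, smul_eq_mul]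
  ring

/-! ### The profile curve of the tall rectangles -/

theorem tallNeck_pos {d : ℝ} (h0 : 0 < d) (h1 : d < 1) : 0 < tallNeck d :=
  div_pos (Real.sqrt_pos.2 (by linarith)) (Real.sqrt_pos.2 (by linarith))

theorem tallNeck_sq {d : ℝ} (h0 : 0 < d) (h1 : d < 1) : tallNeck d ^ 2 = (1 - d) / (1 + d) := by
  rw [tallNeck, div_pow, Real.sq_sqrt (by linarith), Real.sq_sqrt (by linarith)]

theorem tallNeck_lt_one {d : ℝ} (h0 : 0 < d) (h1 : d < 1) : tallNeck d < 1 := by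
  have h : tallNeck d ^ 2 < 1 := by
    rw [tallNeck_sq h0 h1, div_lt_one (by linarith)]; linarith
  nlinarith [tallNeck_pos h0 h1]

theorem eq_tallNeck_iff {d x : ℝ} (h0 : 0 < d) (h1 : d < 1) (hx : 0 < x) :
    x = tallNeck d ↔ 1 - x ^ 2 = d * (1 + x ^ 2) := by
  rw [← sq_eq_sq₀ hx.le (tallNeck_pos h0 h1).le, tallNeck_sq h0 h1, eq_div_iff (by linarith)]
  constructor <;> intro h <;> linarith

theorem tallNeck_le_iff {d x : ℝ} (h0 : 0 < d) (h1 : d < 1) (hx : 0 ≤ x) :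
    tallNeck d ≤ x ↔ (1 - x ^ 2) / (d * (1 + x ^ 2)) ≤ 1 := by
  rw [← sq_le_sq₀ (tallNeck_pos h0 h1).le hx, tallNeck_sq h0 h1, div_le_iff₀ (by linarith),
    div_le_one (by positivity)]
  constructor <;> intro h <;> linarith

/-- Needed because the profile integrand has a vanishing denominator at the neck: a nonnegative
derivative of a continuous function is automatically integrable. -/
theorem integral_eq_sub_of_hasDerivAt_of_nonneg {f f' : ℝ → ℝ} {a b : ℝ} (hab : a ≤ b)
    (hc : ContinuousOn f (Icc a b)) (hd : ∀ x ∈ Ioo a b, HasDerivAt f (f' x) x)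
    (hn : ∀ x ∈ Ioo a b, 0 ≤ f' x) : ∫ x in a..b, f' x = f b - f a := by
  refine intervalIntegral.integral_eq_sub_of_hasDerivAt_of_le hab hc hd ?_
  refine intervalIntegral.intervalIntegrable_deriv_of_nonneg (g := f) ?_ ?_ ?_
  · rwa [uIcc_of_le hab]
  · simpa [hab] using hd
  · simpa [hab] using hn

/-- Substitution v = (1 - x²) / (d (1 + x²)), that is 1 / (d cosh ρ) for x = tanh (ρ / 2); the neck
corresponds to v = 1. The bound on d gives d² < 1/4, where the elliptic integral is under control.
-/
theorem tallProfile_eq {d x : ℝ} (h0 : 0 < d) (h1 : d < 1 / 2) (hx : tallNeck d ≤ x) (hx1 : x < 1) :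
    tallProfile d x = ellHeight (d ^ 2) ((1 - x ^ 2) / (d * (1 + x ^ 2))) := by
  have hd1 : d < 1 := by linarith
  have he : |d ^ 2| < 1 / 4 := by rw [abs_of_nonneg (sq_nonneg d)]; nlinarith
  have hn := tallNeck_pos h0 hd1
  set V : ℝ → ℝ := fun x => (1 - x ^ 2) / (d * (1 + x ^ 2)) with hV
  have hVn : V (tallNeck d) = 1 := by
    have := (eq_tallNeck_iff h0 hd1 hn).1 rfl
    simp only [hV]
    rw [this, div_self (by positivity)]
  have hVpos : ∀ u, 0 < u → u < 1 → 0 < V u := fun u hu0 hu1 =>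
    div_pos (by nlinarith) (by positivity)
  have hVle : ∀ u, tallNeck d ≤ u → V u ≤ 1 := fun u hu =>
    (tallNeck_le_iff h0 hd1 (hn.le.trans hu)).1 hu
  have hDpos : ∀ u, tallNeck d < u → 0 < d ^ 2 * (1 + u ^ 2) ^ 2 - (1 - u ^ 2) ^ 2 ∨ 1 ≤ u := by
    intro u hu
    rcases le_or_gt 1 u with h | h
    · exact Or.inr h
    · left
      have hu0 := hn.trans hu
      have h3 : tallNeck d ^ 2 < u ^ 2 := pow_lt_pow_left₀ hu hn.le two_ne_zero
      rw [tallNeck_sq h0 hd1, div_lt_iff₀ (by linarith)] at h3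
      have : 0 < 1 - u ^ 2 := by nlinarith
      nlinarith
  have key := integral_eq_sub_of_hasDerivAt_of_nonneg (f := fun u => ellHeight (d ^ 2) (V u))
    (f' := fun v => 2 / √(d ^ 2 * (1 + v ^ 2) ^ 2 - (1 - v ^ 2) ^ 2)) hx ?_ ?_ ?_
  · rw [tallProfile, key, hVn, ellHeight_one, sub_zero]
  · refine (continuousOn_ellHeight he).comp (f := V) ?_ fun u hu =>
      ⟨(hVpos u (hn.trans_le hu.1) (hu.2.trans_lt hx1)).le, hVle u hu.1⟩
    exact ContinuousOn.div (by fun_prop) (by fun_prop) fun u _ => by positivity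
  · intro u hu
    have hu0 := hn.trans hu.1
    have hu1 := hu.2.trans hx1
    have hD := (hDpos u hu.1).resolve_right (by linarith)
    -- The two radicands of the elliptic integrand: the first produces the radicand of the profile,
    -- the second is a perfect square.
    have hVu : 1 - V u ^ 2 =
        (d ^ 2 * (1 + u ^ 2) ^ 2 - (1 - u ^ 2) ^ 2) / (d * (1 + u ^ 2)) ^ 2 := by
      simp only [hV]; field_simp
    have hVu' : 1 - d ^ 2 * V u ^ 2 = (2 * u / (1 + u ^ 2)) ^ 2 := by
      simp only [hV]; field_simp; ring
    have hlt : V u < 1 := by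
      have : 0 < 1 - V u ^ 2 := by rw [hVu]; positivity
      nlinarith [hVle u hu.1.le]
    have hdV : HasDerivAt V (-(4 * u) / (d * (1 + u ^ 2) ^ 2)) u := by
      have a1 : HasDerivAt (fun u : ℝ => 1 - u ^ 2) (-(2 * u)) u := by
        simpa using (hasDerivAt_pow 2 u).const_sub 1
      have a2 : HasDerivAt (fun u : ℝ => d * (1 + u ^ 2)) (d * (2 * u)) u := by
        simpa using ((hasDerivAt_pow 2 u).const_add 1).const_mul d
      refine (a1.div a2 (by positivity)).congr_deriv ?_
      field_simp
      ring
    refine ((hasDerivAt_ellHeight he (hVpos u hu0 hu1) hlt).comp u hdV).congr_deriv ?_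
    have hs := Real.sqrt_pos.2 hD
    rw [hVu, hVu', Real.sqrt_div' _ (by positivity), Real.sqrt_sq (by positivity),
      Real.sqrt_sq (by positivity)]
    field_simp
    ring
  · intro u _
    positivity

/-! ### The Cayley transform -/

theorem cayley_im (z : ℂ) :
    (cayley z).im = (1 - z.re ^ 2 - z.im ^ 2) / ((1 + z.re) ^ 2 + z.im ^ 2) := by
  simp [cayley, Complex.div_im, Complex.normSq_apply]
  ring

theorem cayleyIm_eq {a : ℝ} (ha : 0 < 1 + a) : cayleyIm a = (1 - a) / (1 + a) := by
  rw [cayleyIm, cayley_im]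
  simp only [Complex.ofReal_re, Complex.ofReal_im]
  field_simp
  ring

/-- The inverse of the Cayley transform. -/
def cayleyInv (ζ : ℂ) : ℂ := (Complex.I - ζ) / (Complex.I + ζ)

theorem cayleyInv_re (ζ : ℂ) :
    (cayleyInv ζ).re = (1 - ζ.re ^ 2 - ζ.im ^ 2) / (ζ.re ^ 2 + (1 + ζ.im) ^ 2) := by
  simp [cayleyInv, Complex.div_re, Complex.normSq_apply]
  ring

theorem cayley_cayleyInv {ζ : ℂ} (h : 0 < ζ.im) : cayley (cayleyInv ζ) = ζ := by
  have h0 : Complex.I + ζ ≠ 0 := fun h' => by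
    have := congrArg Complex.im h'
    simp at this
    linarith
  rw [cayley, cayleyInv, one_sub_div h0, one_add_div h0]
  field_simp
  ring_nf

theorem cayleyInv_cayley {z : ℂ} (h : ‖z‖ < 1) : cayleyInv (cayley z) = z := by
  have h0 : 1 + z ≠ 0 := fun h' => by
    rw [← neg_eq_iff_add_eq_zero] at h'
    simp [← h'] at h
  rw [cayley, cayleyInv]
  field_simp
  ring_nf

theorem norm_sq_cayleyInv (ζ : ℂ) :
    ‖cayleyInv ζ‖ ^ 2 = (ζ.re ^ 2 + (1 - ζ.im) ^ 2) / (ζ.re ^ 2 + (1 + ζ.im) ^ 2) := by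
  rw [cayleyInv, norm_div, div_pow, Complex.sq_norm, Complex.sq_norm, Complex.normSq_apply,
    Complex.normSq_apply]
  simp
  ring

theorem norm_cayleyInv_lt_one {ζ : ℂ} (h : 0 < ζ.im) : ‖cayleyInv ζ‖ < 1 := by
  have : ‖cayleyInv ζ‖ ^ 2 < 1 := by
    rw [norm_sq_cayleyInv, div_lt_one (by positivity)]
    nlinarith
  nlinarith [norm_nonneg (cayleyInv ζ)]

theorem mem_dilateToOrigin {a : ℝ} {S : Set (ℂ × ℝ)} (hS : ∀ p ∈ S, ‖p.1‖ < 1)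
    (ha : 0 < cayleyIm a) {ζ : ℂ} (hζ : 0 < ζ.im) (t : ℝ) :
    (ζ, t) ∈ dilateToOrigin a S ↔ (cayleyInv (cayleyIm a * ζ), t) ∈ S := by
  have hc : (cayleyIm a : ℂ) ≠ 0 := by exact_mod_cast ha.ne'
  constructor
  · rintro ⟨⟨z, s⟩, hp, h⟩
    obtain ⟨h1, rfl⟩ := Prod.ext_iff.1 h
    simp only at h1
    rw [← h1, show (cayleyIm a : ℂ) * (((1 / cayleyIm a : ℝ) : ℂ) * cayley z) = cayley z by
      push_cast; field_simp, cayleyInv_cayley (hS _ hp)]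
    exact hp
  · intro h
    refine ⟨_, h, ?_⟩
    simp only [Prod.mk.injEq, and_true]
    rw [cayley_cayleyInv (by simp [ha, hζ])]
    push_cast
    field_simp

/-- The two coefficients of the quadratic forms describing the dilated surfaces. -/
def neckA (e : ℝ) : ℝ := (1 + √(1 - e)) / 2

/-- See `neckA`. -/
def neckB (e : ℝ) : ℝ := (1 - √(1 - e)) / 2

/-- The dilation factor μ behaves like d / 2, hence is not differentiable in e = d² at 0. The
combinations 1 / (1 + μ²) and μ² / (1 + μ²) depend on e alone and are smooth there. -/
theorem cayleyIm_tallNeck {d : ℝ} (h0 : 0 < d) (h1 : d < 1) :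
    0 < cayleyIm (tallNeck d) ∧
      2 * cayleyIm (tallNeck d) = d * (1 + cayleyIm (tallNeck d) ^ 2) ∧
      (1 + cayleyIm (tallNeck d) ^ 2) * neckA (d ^ 2) = 1 ∧
      (1 + cayleyIm (tallNeck d) ^ 2) * neckB (d ^ 2) = cayleyIm (tallNeck d) ^ 2 := by
  have hn := tallNeck_pos h0 h1
  have hn1 := tallNeck_lt_one h0 h1
  have hd := (eq_tallNeck_iff h0 h1 hn).1 rfl
  rw [cayleyIm_eq (by linarith)]
  set r := tallNeck d
  have hd' : d = (1 - r ^ 2) / (1 + r ^ 2) := by rw [hd]; field_simp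
  have hs : √(1 - d ^ 2) = 2 * r / (1 + r ^ 2) := by
    rw [show 1 - d ^ 2 = (2 * r / (1 + r ^ 2)) ^ 2 by rw [hd']; field_simp; ring]
    exact Real.sqrt_sq (by positivity)
  refine ⟨div_pos (by linarith) (by linarith), ?_, ?_, ?_⟩
  · rw [hd']; field_simp; ring
  · rw [neckA, hs]; field_simp; ring
  · rw [neckB, hs]; field_simp; ring

/-! ### Tall rectangles as bigraphs -/

/-- Up to a factor, `sinh` of the distance to the axis of the dilated tall rectangle. -/
def tallQ (e x y : ℝ) : ℝ := neckA e - neckB e * (x ^ 2 + y ^ 2)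

/-- The dilated tall rectangle with `d² = e` has height `± ellHeight e (tallV e x y)`. -/
def tallV (e x y : ℝ) : ℝ := y / √(e * y ^ 2 + tallQ e x y ^ 2)

/-- Translations along the geodesic from -i to i preserve the signed distance to it, whose sinh is 2
Re z / (1 - ‖z‖²). The equation says that z and the real point x have the same signed distance. -/
theorem mem_tallRectangle {d : ℝ} (h0 : 0 < d) (h1 : d < 1) (z : ℂ) (t : ℝ) :
    (z, t) ∈ tallRectangle d ↔ ‖z‖ < 1 ∧ ∃ x ∈ Ico (tallNeck d) 1,
      x * (1 - ‖z‖ ^ 2) = z.re * (1 - x ^ 2) ∧ (t = tallProfile d x ∨ t = -tallProfile d x) := by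
  have hn := tallNeck_pos h0 h1
  have hnorm : ‖z‖ ^ 2 = z.re ^ 2 + z.im ^ 2 := by
    rw [Complex.sq_norm, Complex.normSq_apply]; ring
  constructor
  · rintro ⟨x, hx, y, hy, hz, ht⟩
    simp only at hz ht
    have hx0 := hn.trans_le hx.1
    have hre : z.re = (x - x * y ^ 2) / (x ^ 2 * y ^ 2 + 1) := by rw [hz]; rfl
    have him : z.im = (x ^ 2 + 1) * y / (x ^ 2 * y ^ 2 + 1) := by rw [hz]; rfl
    have hp : 0 < x ^ 2 * y ^ 2 + 1 := by positivity
    have hN : 1 - ‖z‖ ^ 2 = (1 - x ^ 2) * (1 - y ^ 2) / (x ^ 2 * y ^ 2 + 1) := by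
      rw [hnorm, hre, him]; field_simp; ring
    have hpos : 0 < 1 - ‖z‖ ^ 2 := by
      rw [hN]
      have hx1 := hx.2
      have hy1 : y ^ 2 < 1 := by nlinarith [hy.1, hy.2]
      exact div_pos (mul_pos (by nlinarith) (by linarith)) hp
    refine ⟨by nlinarith [norm_nonneg z], x, hx, ?_, ht⟩
    rw [hN, hre]
    field_simp
  · rintro ⟨hz, x, hx, heq, ht⟩
    have hx0 := hn.trans_le hx.1
    have hx1 := hx.2
    rw [hnorm] at heq
    have hz2 : z.re ^ 2 + z.im ^ 2 < 1 := by
      rw [← hnorm]; nlinarith [norm_nonneg z]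
    have e2 : x * (1 - (z.re ^ 2 + z.im ^ 2)) - z.re * (1 - x ^ 2) = 0 := by linarith
    have hre1 : 0 < z.re := by
      have h1 : 0 < x * (1 - (z.re ^ 2 + z.im ^ 2)) := mul_pos hx0 (by linarith)
      rw [heq] at h1
      exact pos_of_mul_pos_left h1 (by nlinarith)
    -- Solving z = (x + iY) / (1 - ixY) gives iY = (z - x) / (1 + xz), with M = |1 + xz|². The real
    -- part of the quotient vanishes by the equation; its imaginary part is the translation
    -- parameter Y. The identity `hid` yields |Y| < 1.
    set M := (1 + x * z.re) ^ 2 + (x * z.im) ^ 2 with hM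
    have hMpos : 0 < M := by positivity
    have hid : M ^ 2 - (z.im * (1 + x ^ 2)) ^ 2 =
        M * ((1 - x ^ 2) * (1 - (z.re ^ 2 + z.im ^ 2)) + 4 * x * z.re) := by
      rw [hM]
      linear_combination (x * (1 - (z.re ^ 2 + z.im ^ 2)) - z.re * (1 - x ^ 2)) * e2
    have hlt : (z.im * (1 + x ^ 2)) ^ 2 < M ^ 2 := by
      have h1 : 0 < (1 - x ^ 2) * (1 - (z.re ^ 2 + z.im ^ 2)) :=
        mul_pos (by nlinarith) (by linarith)
      have : 0 < M * ((1 - x ^ 2) * (1 - (z.re ^ 2 + z.im ^ 2)) + 4 * x * z.re) := by positivity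
      linarith
    have hab := abs_lt_of_sq_lt_sq' hlt hMpos.le
    set Y := z.im * (1 + x ^ 2) / M with hY
    have hYM : Y * M = z.im * (1 + x ^ 2) := div_mul_cancel₀ _ hMpos.ne'
    have h3 : z.re - x = -(Y * x * z.im) := by
      refine mul_right_cancel₀ hMpos.ne' ?_
      rw [show -(Y * x * z.im) * M = -(Y * M) * x * z.im by ring, hYM, hM]
      linear_combination -(1 + x * z.re) * e2
    have h4 : z.im = Y * (1 + x * z.re) := by
      refine mul_right_cancel₀ hMpos.ne' ?_
      rw [show Y * (1 + x * z.re) * M = (Y * M) * (1 + x * z.re) by ring, hYM, hM]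
      linear_combination -x * z.im * e2
    have hp : 0 < x ^ 2 * Y ^ 2 + 1 := by positivity
    refine ⟨x, hx, Y, ⟨?_, ?_⟩, Complex.ext ?_ ?_, ht⟩
    · rw [hY, lt_div_iff₀ hMpos]; linarith [hab.1]
    · rw [hY, div_lt_one hMpos]; exact hab.2
    · simp only [sweep]
      rw [eq_div_iff hp.ne']
      linear_combination h3 - Y * x * h4
    · simp only [sweep]
      rw [eq_div_iff hp.ne']
      linear_combination h4 + Y * x * h3

/-- Over the region where `tallQ` is positive, the dilated tall rectangle is the bigraph of
`ellHeight (d ^ 2) (tallV (d ^ 2) x y)`. -/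
theorem mem_dilatedTallRectangle {d : ℝ} (h0 : 0 < d) (h1 : d < 1 / 2) {x y : ℝ} (hy : 0 < y)
    (hQ : 0 < tallQ (d ^ 2) x y) (t : ℝ) :
    ((⟨x, y⟩ : ℂ), t) ∈ dilatedTallRectangle d ↔ tallV (d ^ 2) x y ≤ 1 ∧
      (t = ellHeight (d ^ 2) (tallV (d ^ 2) x y) ∨ t = -ellHeight (d ^ 2) (tallV (d ^ 2) x y)) := by
  have hd1 : d < 1 := by linarith
  have hn := tallNeck_pos h0 hd1
  obtain ⟨hμ, hμd, hμA, hμB⟩ := cayleyIm_tallNeck h0 hd1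
  rw [dilatedTallRectangle, mem_dilateToOrigin (fun p hp =>
    ((mem_tallRectangle h0 hd1 p.1 p.2).1 hp).1) hμ (by simpa using hy),
    mem_tallRectangle h0 hd1]
  set μ := cayleyIm (tallNeck d)
  have hζ : 0 < ((μ : ℂ) * ⟨x, y⟩).im := by simp; positivity
  have hnorm := norm_sq_cayleyInv ((μ : ℂ) * ⟨x, y⟩)
  have hre := cayleyInv_re ((μ : ℂ) * ⟨x, y⟩)
  set z := cayleyInv ((μ : ℂ) * ⟨x, y⟩)
  have hz : ‖z‖ < 1 := norm_cayleyInv_lt_one hζ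
  simp only [Complex.mul_re, Complex.mul_im, Complex.ofReal_re, Complex.ofReal_im, zero_mul,
    sub_zero, add_zero] at hnorm hre
  set Q := tallQ (d ^ 2) x y with hQdef
  have hQμ : 1 - (μ * x) ^ 2 - (μ * y) ^ 2 = (1 + μ ^ 2) * Q := by
    rw [hQdef, tallQ]
    linear_combination -hμA + (x ^ 2 + y ^ 2) * hμB
  have hN : 0 < (μ * x) ^ 2 + (1 + μ * y) ^ 2 := by positivity
  -- In half-plane coordinates the equidistance condition is a quadratic equation in the profile
  -- variable u.
  have hiff : ∀ u : ℝ, u * (1 - ‖z‖ ^ 2) = z.re * (1 - u ^ 2) ↔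
      2 * u * d * y = Q * (1 - u ^ 2) := by
    intro u
    have e1 : u * (1 - ‖z‖ ^ 2) - z.re * (1 - u ^ 2) = (1 + μ ^ 2) /
        ((μ * x) ^ 2 + (1 + μ * y) ^ 2) * (2 * u * d * y - Q * (1 - u ^ 2)) := by
      rw [hnorm, hre, hQμ]
      field_simp
      linear_combination 2 * u * y * hμd
    have hp : (1 + μ ^ 2) / ((μ * x) ^ 2 + (1 + μ * y) ^ 2) ≠ 0 := by positivity
    rw [← sub_eq_zero, e1, mul_eq_zero, or_iff_right hp, sub_eq_zero]
  have hVx : ∀ u : ℝ, 0 < u → u < 1 → 2 * u * d * y = Q * (1 - u ^ 2) →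
      (1 - u ^ 2) / (d * (1 + u ^ 2)) = tallV (d ^ 2) x y := by
    intro u hu0 hu1 hu
    have hp : 0 < 1 - u ^ 2 := by nlinarith
    have e1 : d ^ 2 * y ^ 2 + Q ^ 2 = (d * y * (1 + u ^ 2) / (1 - u ^ 2)) ^ 2 := by
      rw [show Q = 2 * u * d * y / (1 - u ^ 2) by rw [hu]; field_simp]
      field_simp
      ring
    rw [tallV, ← hQdef, e1, Real.sqrt_sq (by positivity)]
    field_simp
  constructor
  · rintro ⟨-, u, hu, heq, ht⟩
    have hu0 := hn.trans_le hu.1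
    have hV := hVx u hu0 hu.2 ((hiff u).1 heq)
    rw [tallProfile_eq h0 h1 hu.1 hu.2, hV] at ht
    exact ⟨hV ▸ (tallNeck_le_iff h0 hd1 hu0.le).1 hu.1, ht⟩
  · rintro ⟨hV1, ht⟩
    set R := √(d ^ 2 * y ^ 2 + Q ^ 2) with hR
    have hR2 : R ^ 2 = d ^ 2 * y ^ 2 + Q ^ 2 := Real.sq_sqrt (by positivity)
    have hRp : 0 < R := Real.sqrt_pos.2 (by positivity)
    have hRQ : Q < R := by
      have : 0 < d ^ 2 * y ^ 2 := by positivity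
      nlinarith
    -- The positive root of Q u² + 2 d y u - Q = 0, with rationalized numerator.
    have hu0 : 0 < Q / (d * y + R) := by positivity
    have hu1 : Q / (d * y + R) < 1 := by
      rw [div_lt_one (by positivity)]
      have : 0 < d * y := by positivity
      linarith
    have hu : 2 * (Q / (d * y + R)) * d * y = Q * (1 - (Q / (d * y + R)) ^ 2) := by
      field_simp
      linear_combination -hR2
    have hV := hVx _ hu0 hu1 hu
    have hmem : tallNeck d ≤ Q / (d * y + R) :=
      (tallNeck_le_iff h0 hd1 hu0.le).2 (hV ▸ hV1)
    refine ⟨hz, _, ⟨hmem, hu1⟩, (hiff _).2 hu, ?_⟩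
    rwa [tallProfile_eq h0 h1 hmem hu1, hV]

/-! ### Catenoids as bigraphs -/

theorem catNeck_pos {κ : ℝ} (h : 0 < κ) : 0 < catNeck κ :=
  sub_pos.2 (Real.sqrt_lt_sqrt h.le (by linarith))

/-- The parameter of the tall rectangle with the same neck as the catenoid of parameter `κ`. -/
def catParam (κ : ℝ) : ℝ := κ / (κ + 1)

theorem catParam_pos {κ : ℝ} (h : 0 < κ) : 0 < catParam κ := by
  unfold catParam; positivity

theorem sqrt_catParam_lt {κ : ℝ} (h : 0 < κ) (h1 : κ < 1 / 3) : √(catParam κ) < 1 / 2 := by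
  rw [Real.sqrt_lt' (by norm_num), catParam, div_lt_iff₀ (by linarith)]
  linarith

theorem catNeck_eq_tallNeck {κ : ℝ} (h : 0 < κ) (h1 : κ < 1 / 3) :
    catNeck κ = tallNeck √(catParam κ) := by
  have hd := sqrt_catParam_lt h h1
  rw [eq_tallNeck_iff (Real.sqrt_pos.2 (catParam_pos h)) (by linarith) (catNeck_pos h), catParam,
    Real.sqrt_div h.le, catNeck]
  have hs1 := Real.sq_sqrt h.le
  have hs2 := Real.sq_sqrt (show 0 ≤ κ + 1 by linarith)
  have hs3 := Real.sqrt_pos.2 (show 0 < κ + 1 by linarith)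
  field_simp
  linear_combination (√κ - √(κ + 1)) * hs2 + (√(κ + 1) - √κ) * hs1

/-- With e = κ / (κ + 1), one has 4κu² - (1 - u²)² = (κ + 1) (e (1 + u²)² - (1 - u²)²), and 1 / (κ +
1) = 1 - e. -/
theorem catProfile_eq {κ : ℝ} (h : 0 < κ) (h1 : κ < 1 / 3) (r : ℝ) :
    catProfile κ r = √(1 - catParam κ) * tallProfile √(catParam κ) r := by
  rw [catProfile, tallProfile, catNeck_eq_tallNeck h h1, ← intervalIntegral.integral_const_mul]
  congr 1
  ext u
  have he : 1 - catParam κ = 1 / (κ + 1) := by unfold catParam; field_simp; ring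
  have hs3 := Real.sqrt_pos.2 (show 0 < κ + 1 by linarith)
  rw [Real.sq_sqrt (catParam_pos h).le, show catParam κ * (1 + u ^ 2) ^ 2 - (1 - u ^ 2) ^ 2 =
    (4 * κ * u ^ 2 - (1 - u ^ 2) ^ 2) / (κ + 1) by unfold catParam; field_simp; ring, he,
    Real.sqrt_div' _ (by linarith), Real.sqrt_div' _ (by linarith), Real.sqrt_one]
  field_simp

/-- The dilated catenoid has height `± √(1 - e) * ellHeight e (catV e x y)` for
`e = catParam κ`. -/
def catV (e x y : ℝ) : ℝ := y / (neckA e + neckB e * (x ^ 2 + y ^ 2))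

theorem mem_dilatedCatenoid {κ : ℝ} (h : 0 < κ) (h1 : κ < 1 / 3) {x y : ℝ} (hy : 0 < y) (t : ℝ) :
    ((⟨x, y⟩ : ℂ), t) ∈ dilatedCatenoid κ ↔ catV (catParam κ) x y ≤ 1 ∧
      (t = √(1 - catParam κ) * ellHeight (catParam κ) (catV (catParam κ) x y) ∨
        t = -(√(1 - catParam κ) * ellHeight (catParam κ) (catV (catParam κ) x y))) := by
  have h0 := Real.sqrt_pos.2 (catParam_pos h)
  have h12 := sqrt_catParam_lt h h1
  have hd2 := Real.sq_sqrt (catParam_pos h).le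
  set e := catParam κ with he
  set d := √e
  have hd1 : d < 1 := by linarith
  have hn := tallNeck_pos h0 hd1
  obtain ⟨hμ, hμd, hμA, hμB⟩ := cayleyIm_tallNeck h0 hd1
  rw [hd2] at hμA hμB
  rw [dilatedCatenoid, catNeck_eq_tallNeck h h1, ← he, mem_dilateToOrigin (fun p hp => hp.1.2) hμ
    (by simpa using hy)]
  set μ := cayleyIm (tallNeck d)
  have hζ : 0 < ((μ : ℂ) * ⟨x, y⟩).im := by simp; positivity
  have hnorm := norm_sq_cayleyInv ((μ : ℂ) * ⟨x, y⟩)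
  have hz : ‖cayleyInv ((μ : ℂ) * ⟨x, y⟩)‖ < 1 := norm_cayleyInv_lt_one hζ
  simp only [Complex.mul_re, Complex.mul_im, Complex.ofReal_re, Complex.ofReal_im, zero_mul,
    sub_zero, add_zero] at hnorm
  simp only [catenoid, mem_ofPred_eq, mem_Ico]
  have hr0 := norm_nonneg (cayleyInv ((μ : ℂ) * ⟨x, y⟩))
  set r := ‖cayleyInv ((μ : ℂ) * ⟨x, y⟩)‖
  have hN : 0 < (μ * x) ^ 2 + (1 + μ * y) ^ 2 := by positivity
  have hV : (1 - r ^ 2) / (d * (1 + r ^ 2)) = catV e x y := by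
    have e1 : neckA e + neckB e * (x ^ 2 + y ^ 2) =
        (1 + μ ^ 2 * (x ^ 2 + y ^ 2)) / (1 + μ ^ 2) := by
      field_simp
      linear_combination hμA + (x ^ 2 + y ^ 2) * hμB
    have e2 : 1 - r ^ 2 = 4 * (μ * y) / ((μ * x) ^ 2 + (1 + μ * y) ^ 2) := by
      rw [hnorm]; field_simp; ring
    have e3 : 1 + r ^ 2 =
        2 * (1 + μ ^ 2 * (x ^ 2 + y ^ 2)) / ((μ * x) ^ 2 + (1 + μ * y) ^ 2) := by
      rw [hnorm]; field_simp; ring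
    rw [catV, e1, e2, e3]
    field_simp
    linear_combination 2 * hμd
  rw [catNeck_eq_tallNeck h h1, ← he, tallNeck_le_iff h0 hd1 hr0, hV, catProfile_eq h h1, ← he]
  constructor
  · rintro ⟨⟨ha, -⟩, ht⟩
    rw [tallProfile_eq h0 h12 ((tallNeck_le_iff h0 hd1 hr0).2 (hV ▸ ha)) hz, hV, hd2] at ht
    exact ⟨ha, ht⟩
  · rintro ⟨ha, ht⟩
    refine ⟨⟨ha, hz⟩, ?_⟩
    rwa [tallProfile_eq h0 h12 ((tallNeck_le_iff h0 hd1 hr0).2 (hV ▸ ha)) hz, hV, hd2]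

/-! ### Values at the limit parameter -/

theorem neckA_zero : neckA 0 = 1 := by norm_num [neckA]

theorem neckB_zero : neckB 0 = 0 := by norm_num [neckB]

theorem tallQ_zero (x y : ℝ) : tallQ 0 x y = 1 := by simp [tallQ, neckA_zero, neckB_zero]

theorem tallV_zero (x y : ℝ) : tallV 0 x y = y := by simp [tallV, tallQ_zero]

theorem catV_zero (x y : ℝ) : catV 0 x y = y := by simp [catV, neckA_zero, neckB_zero]

/-! ### Smooth convergence of the tall rectangles -/

/-- A defining function of the dilated tall rectangles, jointly in the parameter `d` and the
point. -/
def tallDefining (p : ℝ × ℂ × ℝ) : ℝ :=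
  p.2.2 ^ 2 - (1 - tallV (p.1 ^ 2) p.2.1.re p.2.1.im) *
    ellMean (p.1 ^ 2) (1 - tallV (p.1 ^ 2) p.2.1.re p.2.1.im) ^ 2

/-- A domain on which `tallV` is smooth. -/
def tallRegion : Set (ℝ × ℂ × ℝ) :=
  {p | p.1 ^ 2 < 1 ∧ 0 < p.2.1.im ∧ 0 < tallQ (p.1 ^ 2) p.2.1.re p.2.1.im}

/-- A domain on which `tallDefining` is smooth. -/
def tallDomain : Set (ℝ × ℂ × ℝ) :=
  tallRegion ∩ (fun p => (p.1 ^ 2, 1 - tallV (p.1 ^ 2) p.2.1.re p.2.1.im)) ⁻¹' ellDomain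

theorem isOpen_tallRegion : IsOpen tallRegion := by
  have hre : Continuous fun p : ℝ × ℂ × ℝ => p.2.1.re := by fun_prop
  have him : Continuous fun p : ℝ × ℂ × ℝ => p.2.1.im := by fun_prop
  have h1 : IsOpen {p : ℝ × ℂ × ℝ | p.1 ^ 2 < 1} := isOpen_lt (by fun_prop) (by fun_prop)
  have h2 : IsOpen {p : ℝ × ℂ × ℝ | 0 < p.2.1.im} := isOpen_lt (by fun_prop) (by fun_prop)
  have h3 : IsOpen {p : ℝ × ℂ × ℝ | 0 < tallQ (p.1 ^ 2) p.2.1.re p.2.1.im} := by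
    refine isOpen_lt continuous_const ?_
    unfold tallQ neckA neckB
    fun_prop
  exact h1.and (h2.and h3)

theorem contDiffOn_tallV :
    ContDiffOn ℝ ∞ (fun p : ℝ × ℂ × ℝ => tallV (p.1 ^ 2) p.2.1.re p.2.1.im) tallRegion := by
  intro p hp
  obtain ⟨h1, h2, h3⟩ := hp
  have hre : ContDiff ℝ ∞ fun p : ℝ × ℂ × ℝ => p.2.1.re :=
    Complex.reCLM.contDiff.comp (contDiff_fst.comp contDiff_snd)
  have him : ContDiff ℝ ∞ fun p : ℝ × ℂ × ℝ => p.2.1.im :=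
    Complex.imCLM.contDiff.comp (contDiff_fst.comp contDiff_snd)
  have hs : ContDiffAt ℝ ∞ (fun p : ℝ × ℂ × ℝ => √(1 - p.1 ^ 2)) p :=
    ContDiffAt.sqrt (by fun_prop) (by linarith)
  have hQ : ContDiffAt ℝ ∞ (fun p : ℝ × ℂ × ℝ => tallQ (p.1 ^ 2) p.2.1.re p.2.1.im) p := by
    unfold tallQ neckA neckB
    exact ((contDiffAt_const.add hs).div_const 2).sub (((contDiffAt_const.sub hs).div_const 2).mul
      ((hre.contDiffAt.pow 2).add (him.contDiffAt.pow 2)))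
  have hpos : 0 < p.1 ^ 2 * p.2.1.im ^ 2 + tallQ (p.1 ^ 2) p.2.1.re p.2.1.im ^ 2 := by positivity
  have hS : ContDiffAt ℝ ∞ (fun p : ℝ × ℂ × ℝ =>
      p.1 ^ 2 * p.2.1.im ^ 2 + tallQ (p.1 ^ 2) p.2.1.re p.2.1.im ^ 2) p :=
    ((contDiffAt_fst.pow 2).mul (him.contDiffAt.pow 2)).add (hQ.pow 2)
  exact (him.contDiffAt.div (hS.sqrt hpos.ne') (Real.sqrt_pos.2 hpos).ne').contDiffWithinAt

theorem isOpen_tallDomain : IsOpen tallDomain := by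
  refine ContinuousOn.isOpen_inter_preimage ?_ isOpen_tallRegion isOpen_ellDomain
  exact ContinuousOn.prodMk (by fun_prop) (continuousOn_const.sub contDiffOn_tallV.continuousOn)

/-- Squaring the height removes √(1 - v), the only factor that is singular at the neck. -/
theorem contDiffOn_tallDefining : ContDiffOn ℝ ∞ tallDefining tallDomain := by
  have hV := contDiffOn_tallV.mono (inter_subset_left : tallDomain ⊆ tallRegion)
  have h1 : ContDiffOn ℝ ∞ (fun p : ℝ × ℂ × ℝ =>
      1 - tallV (p.1 ^ 2) p.2.1.re p.2.1.im) tallDomain := contDiffOn_const.sub hV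
  have hM := contDiffOn_ellMean.comp ((contDiffOn_fst.pow 2).prodMk h1) fun p hp => hp.2
  exact ((contDiff_snd.comp contDiff_snd).contDiffOn.pow 2).sub (h1.mul (hM.pow 2))

theorem zero_mem_tallDomain {q : ℂ × ℝ} (hq : q ∈ halfSpace) : ((0 : ℝ), q) ∈ tallDomain := by
  have hq' : 0 < q.1.im := hq
  refine ⟨⟨by norm_num, hq, ?_⟩, ?_⟩
  · norm_num [tallQ_zero]
  · simp only [mem_preimage, ne_eq, OfNat.ofNat_ne_zero, not_false_eq_true, zero_pow, tallV_zero]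
    exact ⟨by simp only; linarith, by simp⟩

/-- The condition v ≤ 1 need not be imposed on the zero set: it follows from t² ≥ 0 and M > 0. -/
theorem sq_eq_mul_sq_iff {t v M : ℝ} (hM : 0 < M) :
    t ^ 2 - (1 - v) * M ^ 2 = 0 ↔ v ≤ 1 ∧ (t = √(1 - v) * M ∨ t = -(√(1 - v) * M)) := by
  rw [← sq_eq_sq_iff_eq_or_eq_neg, mul_pow, sub_eq_zero]
  constructor
  · intro h
    have hv : v ≤ 1 := by
      by_contra hv
      have : 0 < (v - 1) * M ^ 2 := mul_pos (by linarith) (by positivity)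
      nlinarith [sq_nonneg t]
    exact ⟨hv, by rw [h, Real.sq_sqrt (by linarith)]⟩
  · rintro ⟨hv, h⟩
    rwa [Real.sq_sqrt (by linarith)] at h

theorem mem_dilatedTallRectangle_iff_tallDefining {d : ℝ} (h0 : 0 < d) (h1 : d < 1 / 2)
    {q : ℂ × ℝ} (hq : (d, q) ∈ tallDomain) :
    q ∈ dilatedTallRectangle d ↔ tallDefining (d, q) = 0 := by
  obtain ⟨⟨-, hy, hQ⟩, hM⟩ := hq
  have := mem_dilatedTallRectangle h0 h1 hy hQ q.2
  rw [tallDefining, sq_eq_mul_sq_iff (ellMean_pos hM)]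
  exact this

theorem mem_parabolicCatenoid_iff {x y : ℝ} (hy : 0 < y) (t : ℝ) :
    ((⟨x, y⟩ : ℂ), t) ∈ parabolicCatenoid ↔
      y ≤ 1 ∧ (t = Real.arccos y ∨ t = -Real.arccos y) := by
  constructor
  · rintro ⟨⟨h1, h2⟩, h3⟩
    simp only at h1 h2 h3
    refine ⟨h3 ▸ Real.cos_le_one t, ?_⟩
    rcases le_total 0 t with ht | ht
    · left; rw [h3, Real.arccos_cos ht (by linarith [Real.pi_pos])]
    · right
      rw [h3, ← Real.cos_neg, Real.arccos_cos (by linarith) (by linarith [Real.pi_pos]), neg_neg]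
  · rintro ⟨hy1, ht⟩
    have h1 : Real.arccos y < Real.pi / 2 := Real.arccos_lt_pi_div_two.2 hy
    have h2 := Real.arccos_nonneg y
    have h3 := Real.cos_arccos (by linarith : -1 ≤ y) hy1
    rcases ht with rfl | rfl
    · exact ⟨⟨by linarith, h1⟩, h3.symm⟩
    · exact ⟨⟨by simp only; linarith, by simp only; linarith⟩, by simp only [Real.cos_neg, h3]⟩

theorem tallDefining_zero (q : ℂ × ℝ) :
    tallDefining (0, q) = q.2 ^ 2 - (1 - q.1.im) * ellMean 0 (1 - q.1.im) ^ 2 := by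
  simp [tallDefining, tallV_zero]

theorem zero_ellDomain {y : ℝ} (hy : 0 < y) : ((0 : ℝ), 1 - y) ∈ ellDomain :=
  ⟨by simp only; linarith, by simp⟩

theorem mem_parabolicCatenoid_iff_tallDefining {q : ℂ × ℝ} (hq : q ∈ halfSpace) :
    q ∈ parabolicCatenoid ↔ tallDefining (0, q) = 0 := by
  have hy : 0 < q.1.im := hq
  rw [tallDefining_zero, sq_eq_mul_sq_iff (ellMean_pos (zero_ellDomain hy))]
  refine (mem_parabolicCatenoid_iff (x := q.1.re) hy q.2).trans (and_congr_right fun h => ?_)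
  rw [← ellHeight_zero hy h, ellHeight]

theorem contDiffOn_tallDefining_slice (d : ℝ) {s : Set (ℂ × ℝ)}
    (h : ∀ q ∈ s, (d, q) ∈ tallDomain) : ContDiffOn ℝ ∞ (fun q => tallDefining (d, q)) s :=
  contDiffOn_tallDefining.comp (by fun_prop) h

theorem isOpen_halfSpace : IsOpen halfSpace :=
  isOpen_lt continuous_const (Complex.continuous_im.comp continuous_fst)

/-- A vanishing t-derivative forces t = 0, so the equation gives y = 1; there the y-derivative is
`ellMean 0 0 ^ 2`, which is positive. -/
theorem fderiv_tallDefining_zero_ne {q : ℂ × ℝ} (hq : q ∈ halfSpace)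
    (h0 : tallDefining (0, q) = 0) : fderiv ℝ (fun q => tallDefining (0, q)) q ≠ 0 := by
  intro hf
  have hy : 0 < q.1.im := hq
  have hd : HasFDerivAt (fun q => tallDefining (0, q)) (0 : ℂ × ℝ →L[ℝ] ℝ) q := by
    rw [← hf]
    exact (((contDiffOn_tallDefining_slice 0 fun q hq => zero_mem_tallDomain hq).contDiffAt
      (isOpen_halfSpace.mem_nhds hq)).differentiableAt (by simp)).hasFDerivAt
  simp only [tallDefining_zero] at hd h0
  have ht : q.2 = 0 := by
    have h1 := (hd.comp q.2 (hasFDerivAt_prodMk_right (𝕜 := ℝ) q.1 q.2)).hasDerivAt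
    have h2 := ((hasDerivAt_pow 2 q.2).sub_const
      ((1 - q.1.im) * ellMean 0 (1 - q.1.im) ^ 2)).unique h1
    simpa using h2
  have hM := ellMean_pos (zero_ellDomain hy)
  have hy1 : q.1.im = 1 := by
    rw [ht] at h0
    have : (1 - q.1.im) * ellMean 0 (1 - q.1.im) ^ 2 = 0 := by linarith
    rcases mul_eq_zero.1 this with h | h
    · linarith
    · exact absurd h (by positivity)
  have hc : HasDerivAt (fun s : ℝ => ((⟨q.1.re, s⟩ : ℂ), q.2)) (Complex.I, 0) q.1.im := by
    have : HasDerivAt (fun s : ℝ => (q.1.re : ℂ) + s * Complex.I) Complex.I q.1.im := by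
      simpa using (((hasDerivAt_id q.1.im).ofReal_comp).mul_const Complex.I).const_add (q.1.re : ℂ)
    refine HasDerivAt.prodMk ?_ (hasDerivAt_const _ _)
    exact this.congr_of_eventuallyEq (.of_forall fun s => Complex.mk_eq_add_mul_I _ _)
  have h1 := HasFDerivAt.comp_hasDerivAt q.1.im hd hc
  have hMd : DifferentiableAt ℝ (fun s : ℝ => ellMean 0 (1 - s)) q.1.im := by
    have := (contDiffOn_ellMean.contDiffAt (isOpen_ellDomain.mem_nhds
      (zero_ellDomain hy))).differentiableAt (by simp)
    exact this.comp (f := fun s : ℝ => ((0 : ℝ), 1 - s)) q.1.im (by fun_prop)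
  have h2 := ((((hasDerivAt_id q.1.im).const_sub 1).mul (hMd.hasDerivAt.pow 2)).const_sub
    (q.2 ^ 2)).unique h1
  simp only [hy1, id, sub_self, zero_mul, _root_.zero_apply, Pi.pow_apply] at h2
  rw [hy1, sub_self] at hM
  nlinarith

theorem convergesSmoothly_dilatedTallRectangle :
    ConvergesSmoothly halfSpace dilatedTallRectangle (𝓝[>] 0) parabolicCatenoid := by
  intro p hp
  obtain ⟨r, hr, hrΩ⟩ := Metric.nhds_basis_closedBall.mem_iff.1 (isOpen_halfSpace.mem_nhds hp)
  have hK := isCompact_closedBall p r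
  have hVΩ : Metric.ball p r ⊆ halfSpace := Metric.ball_subset_closedBall.trans hrΩ
  -- Tube lemma: the open domain contains the slice {0} × K, hence all nearby slices over the
  -- compact ball K.
  have hev : ∀ᶠ d in 𝓝 (0 : ℝ), ∀ q ∈ Metric.closedBall p r, (d, q) ∈ tallDomain :=
    hK.eventually_forall_of_forall_eventually fun q hq =>
      isOpen_tallDomain.mem_nhds (zero_mem_tallDomain (hrΩ hq))
  refine ⟨Metric.ball p r, Metric.isOpen_ball, Metric.mem_ball_self hr, hVΩ,
    fun d q => tallDefining (d, q), fun q => tallDefining (0, q), ⟨?_, ?_, ?_⟩, ?_, ?_⟩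
  · exact contDiffOn_tallDefining_slice 0 fun q hq => zero_mem_tallDomain (hVΩ hq)
  · exact fun q hq => mem_parabolicCatenoid_iff_tallDefining (hVΩ hq)
  · exact fun q hq => fderiv_tallDefining_zero_ne (hVΩ hq)
  · filter_upwards [hev.filter_mono nhdsWithin_le_nhds, Ioo_mem_nhdsGT (show (0 : ℝ) < 1 / 2 by
      norm_num)] with d hd hd2
    have hd' : ∀ q ∈ Metric.ball p r, (d, q) ∈ tallDomain :=
      fun q hq => hd q (Metric.ball_subset_closedBall hq)
    exact ⟨contDiffOn_tallDefining_slice d hd', fun q hq =>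
      mem_dilatedTallRectangle_iff_tallDefining hd2.1 hd2.2 (hd' q hq)⟩
  · intro n u hu
    have := tendstoUniformlyOn_iteratedFDeriv_slice isOpen_tallDomain contDiffOn_tallDefining hK
      (a := 0) (fun q hq => zero_mem_tallDomain (hrΩ hq)) n u hu
    filter_upwards [this.filter_mono nhdsWithin_le_nhds] with d hd q hq
    exact hd q (Metric.ball_subset_closedBall hq)

/-! ### The deformations and their initial velocities -/

theorem csSup_pair_neg {h : ℝ} (hh : 0 ≤ h) : sSup {h, -h} = h := by
  rw [csSup_pair]; exact max_eq_left (by linarith)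

theorem hasDerivAt_sqrt_one_sub : HasDerivAt (fun e : ℝ => √(1 - e)) (-1 / 2) 0 := by
  have := ((hasDerivAt_id (0 : ℝ)).const_sub 1).sqrt (by simp)
  simpa using this

theorem hasDerivAt_neckA : HasDerivAt neckA (-1 / 4) 0 :=
  ((hasDerivAt_sqrt_one_sub.const_add 1).div_const 2).congr_deriv (by norm_num)

theorem hasDerivAt_neckB : HasDerivAt neckB (1 / 4) 0 :=
  ((hasDerivAt_sqrt_one_sub.const_sub 1).div_const 2).congr_deriv (by norm_num)

theorem hasDerivAt_tallQ (x y : ℝ) :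
    HasDerivAt (fun e => tallQ e x y) (-(1 + x ^ 2 + y ^ 2) / 4) 0 :=
  (hasDerivAt_neckA.sub (hasDerivAt_neckB.mul_const (x ^ 2 + y ^ 2))).congr_deriv (by ring)

theorem hasDerivAt_tallV (x y : ℝ) :
    HasDerivAt (fun e => tallV e x y) (-(y ^ 3 - y - x ^ 2 * y) / 4) 0 := by
  have h1 := ((hasDerivAt_id (0 : ℝ)).mul_const (y ^ 2)).add ((hasDerivAt_tallQ x y).pow 2)
  have h2 := (hasDerivAt_const (0 : ℝ) y).div (h1.sqrt (by simp [tallQ_zero]))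
    (by simp [tallQ_zero])
  refine h2.congr_deriv ?_
  simp [tallQ_zero]
  ring

theorem hasDerivAt_catV (x y : ℝ) :
    HasDerivAt (fun e => catV e x y) (y * (1 - x ^ 2 - y ^ 2) / 4) 0 := by
  have h1 := hasDerivAt_neckA.add (hasDerivAt_neckB.mul_const (x ^ 2 + y ^ 2))
  have h2 := (hasDerivAt_const (0 : ℝ) y).div h1 (by simp [neckA_zero, neckB_zero])
  refine h2.congr_deriv ?_
  simp [neckA_zero, neckB_zero]
  ring

theorem hasDerivAt_catParam : HasDerivAt catParam 1 0 := by
  have := (hasDerivAt_id (0 : ℝ)).div ((hasDerivAt_id (0 : ℝ)).add_const 1) (by simp)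
  exact this.congr_deriv (by simp)

theorem catParam_zero : catParam 0 = 0 := by simp [catParam]

theorem setOf_parabolicCatenoid (x : ℝ) {y : ℝ} (hy : 0 < y) (hy1 : y < 1) :
    {t : ℝ | ((⟨x, y⟩ : ℂ), t) ∈ parabolicCatenoid} = {Real.arccos y, -Real.arccos y} := by
  ext t
  simp [mem_parabolicCatenoid_iff hy, hy1.le]

theorem topHalf_parabolicCatenoid (x : ℝ) {y : ℝ} (hy : 0 < y) (hy1 : y < 1) :
    topHalf parabolicCatenoid x y = (⟨x, y⟩, Real.arccos y) := by
  rw [topHalf, setOf_parabolicCatenoid x hy hy1, csSup_pair_neg (Real.arccos_nonneg y)]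

theorem eventually_setOf_dilatedTallRectangle (x : ℝ) {y : ℝ} (hy : 0 < y) (hy1 : y < 1) :
    ∀ᶠ e in 𝓝[>] (0 : ℝ), 0 < ellHeight e (tallV e x y) ∧
      {t : ℝ | ((⟨x, y⟩ : ℂ), t) ∈ dilatedTallRectangle √e} =
        {ellHeight e (tallV e x y), -ellHeight e (tallV e x y)} := by
  have hc := (hasDerivAt_tallV x y).continuousAt
  have hQ := continuousAt_const.eventually_lt (hasDerivAt_tallQ x y).continuousAt
    (show 0 < tallQ 0 x y by simp [tallQ_zero])
  have hV := hc.eventually_lt continuousAt_const (show tallV 0 x y < 1 by rwa [tallV_zero])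
  have hV0 := continuousAt_const.eventually_lt hc (show 0 < tallV 0 x y by rwa [tallV_zero])
  filter_upwards [hQ.filter_mono nhdsWithin_le_nhds, hV.filter_mono nhdsWithin_le_nhds,
    hV0.filter_mono nhdsWithin_le_nhds, Ioo_mem_nhdsGT (show (0 : ℝ) < 1 / 4 by norm_num)]
    with e hQ hV hV0 he
  refine ⟨ellHeight_pos (by rw [abs_of_pos he.1]; exact he.2) hV0.le hV, ?_⟩
  ext t
  have hs : √e < 1 / 2 := by rw [Real.sqrt_lt' (by norm_num)]; linarith [he.2]
  have := mem_dilatedTallRectangle (Real.sqrt_pos.2 he.1) hs (x := x) hy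
    (by rwa [Real.sq_sqrt he.1.le]) t
  rw [Real.sq_sqrt he.1.le] at this
  simp [this, hV.le]

theorem eventually_setOf_dilatedCatenoid (x : ℝ) {y : ℝ} (hy : 0 < y) (hy1 : y < 1) :
    ∀ᶠ κ in 𝓝[>] (0 : ℝ),
      0 < √(1 - catParam κ) * ellHeight (catParam κ) (catV (catParam κ) x y) ∧
      {t : ℝ | ((⟨x, y⟩ : ℂ), t) ∈ dilatedCatenoid κ} =
        {√(1 - catParam κ) * ellHeight (catParam κ) (catV (catParam κ) x y),
          -(√(1 - catParam κ) * ellHeight (catParam κ) (catV (catParam κ) x y))} := by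
  have hc : ContinuousAt (fun κ => catV (catParam κ) x y) 0 :=
    ContinuousAt.comp_of_eq (g := fun e => catV e x y) (hasDerivAt_catV x y).continuousAt
      hasDerivAt_catParam.continuousAt catParam_zero
  have hV := hc.eventually_lt continuousAt_const
    (show catV (catParam 0) x y < 1 by rwa [catParam_zero, catV_zero])
  have hV0 := continuousAt_const.eventually_lt hc
    (show 0 < catV (catParam 0) x y by rwa [catParam_zero, catV_zero])
  filter_upwards [hV.filter_mono nhdsWithin_le_nhds,
    hV0.filter_mono nhdsWithin_le_nhds, Ioo_mem_nhdsGT (show (0 : ℝ) < 1 / 3 by norm_num)]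
    with κ hV hV0 hκ
  have he0 := catParam_pos hκ.1
  have he : catParam κ < 1 / 4 := by
    have := hκ.1
    rw [catParam, div_lt_iff₀ (by linarith)]; linarith [hκ.2]
  refine ⟨mul_pos (Real.sqrt_pos.2 (by linarith))
    (ellHeight_pos (by rwa [abs_of_pos he0]) hV0.le hV), ?_⟩
  ext t
  simp [mem_dilatedCatenoid hκ.1 hκ.2 hy, hV.le]

theorem tallDeformation_zero : tallDeformation 0 = topHalf parabolicCatenoid := by
  simp [tallDeformation]

theorem catDeformation_zero : catDeformation 0 = topHalf parabolicCatenoid := by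
  simp [catDeformation]

theorem hasDerivWithinAt_tallDeformation (x : ℝ) {y : ℝ} (hy : 0 < y) (hy1 : y < 1) :
    HasDerivWithinAt (fun e => tallDeformation e x y)
      (0, 1 / 4 * (Real.arccos y + y * √(1 - y ^ 2)) -
        -(y ^ 3 - y - x ^ 2 * y) / 4 / √(1 - y ^ 2)) (Ici 0) 0 := by
  have h1 := (hasDerivAt_ellHeight_comp (tallV_zero x y) hy hy1 (hasDerivAt_tallV x y))
  refine (((hasDerivAt_const (0 : ℝ) (⟨x, y⟩ : ℂ)).prodMk h1).hasDerivWithinAt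
    (s := Ici 0)).congr_of_eventuallyEq ?_ ?_
  -- The parameter 0 is treated apart, since there the deformation is the parabolic catenoid by
  -- definition.
  · rw [← Ioi_insert, nhdsWithin_insert, EventuallyEq, eventually_sup]
    constructor
    · simp [tallDeformation_zero, topHalf_parabolicCatenoid x hy hy1, tallV_zero,
        ellHeight_zero hy hy1.le]
    · filter_upwards [eventually_setOf_dilatedTallRectangle x hy hy1, self_mem_nhdsWithin]
        with e he he0
      rw [tallDeformation, if_pos (mem_Ioi.1 he0), topHalf, he.2, csSup_pair_neg he.1.le]
  · simp [tallDeformation_zero, topHalf_parabolicCatenoid x hy hy1, tallV_zero,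
        ellHeight_zero hy hy1.le]

/-- The extra term -½ arccos y comes from the factor √(1 - e); reparametrizing by κ costs nothing,
as κ / (κ + 1) has derivative 1 at 0. -/
theorem hasDerivWithinAt_catDeformation (x : ℝ) {y : ℝ} (hy : 0 < y) (hy1 : y < 1) :
    HasDerivWithinAt (fun κ => catDeformation κ x y)
      (0, -1 / 2 * Real.arccos y + (1 / 4 * (Real.arccos y + y * √(1 - y ^ 2)) -
        y * (1 - x ^ 2 - y ^ 2) / 4 / √(1 - y ^ 2))) (Ici 0) 0 := by
  have h1 := hasDerivAt_sqrt_one_sub.mul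
    (hasDerivAt_ellHeight_comp (catV_zero x y) hy hy1 (hasDerivAt_catV x y))
  have h2 := HasDerivAt.comp_of_eq (0 : ℝ) h1 hasDerivAt_catParam catParam_zero.symm
  have hz : catDeformation 0 x y = ((⟨x, y⟩ : ℂ), √(1 - catParam 0) *
      ellHeight (catParam 0) (catV (catParam 0) x y)) := by
    simp [catDeformation_zero, topHalf_parabolicCatenoid x hy hy1, catParam_zero, catV_zero,
        ellHeight_zero hy hy1.le]
  refine ((((hasDerivAt_const (0 : ℝ) (⟨x, y⟩ : ℂ)).prodMk h2).hasDerivWithinAt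
    (s := Ici 0)).congr_of_eventuallyEq ?_ hz).congr_deriv ?_
  · rw [← Ioi_insert, nhdsWithin_insert, EventuallyEq, eventually_sup]
    constructor
    · exact hz
    · filter_upwards [eventually_setOf_dilatedCatenoid x hy hy1, self_mem_nhdsWithin]
        with κ hκ hκ0
      rw [catDeformation, if_pos (mem_Ioi.1 hκ0), topHalf, hκ.2, csSup_pair_neg hκ.1.le]
      rfl
  · simp [catV_zero, ellHeight_zero hy hy1.le]

theorem jacobiField_tallDeformation (x : ℝ) {y : ℝ} (hy : 0 < y) (hy1 : y < 1) :
    jacobiField tallDeformation gaussMap x y =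
      -(1 / 4) * (√(1 - y ^ 2) * Real.arccos y - x ^ 2 * y) := by
  have hp : 0 < 1 - y ^ 2 := by nlinarith
  have hs := Real.sqrt_pos.2 hp
  rw [jacobiField, initialVelocity, (hasDerivWithinAt_tallDeformation x hy hy1).derivWithin
    (uniqueDiffOn_Ici 0 0 self_mem_Ici)]
  simp only [metric, gaussMap, Complex.zero_re, Complex.zero_im, mul_zero, add_zero, zero_div,
    zero_add]
  field_simp
  linear_combination (-y) * Real.sq_sqrt hp.le

theorem jacobiField_catDeformation (x : ℝ) {y : ℝ} (hy : 0 < y) (hy1 : y < 1) :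
    jacobiField catDeformation gaussMap x y =
      1 / 4 * (√(1 - y ^ 2) * Real.arccos y - x ^ 2 * y) := by
  have hp : 0 < 1 - y ^ 2 := by nlinarith
  have hs := Real.sqrt_pos.2 hp
  rw [jacobiField, initialVelocity, (hasDerivWithinAt_catDeformation x hy hy1).derivWithin
    (uniqueDiffOn_Ici 0 0 self_mem_Ici)]
  simp only [metric, gaussMap, Complex.zero_re, Complex.zero_im, mul_zero, add_zero, zero_div,
    zero_add]
  field_simp
  linear_combination (-2 * y) * Real.sq_sqrt hp.le

/-! ### The Jacobi equation of the parabolic catenoid -/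

variable {y : ℝ}

theorem eventually_mem_strip (hy : 0 < y) (hy1 : y < 1) : ∀ᶠ s in 𝓝 y, 0 < s ∧ s < 1 :=
  Ioo_mem_nhds hy hy1

theorem one_sub_sq_pos (hy : 0 < y) (hy1 : y < 1) : 0 < 1 - y ^ 2 := by nlinarith

theorem hasDerivAt_sqrt_one_sub_sq (hy : 0 < y) (hy1 : y < 1) :
    HasDerivAt (fun s : ℝ => √(1 - s ^ 2)) (-y / √(1 - y ^ 2)) y := by
  have hp := one_sub_sq_pos hy hy1
  have hs := Real.sqrt_pos.2 hp
  have h : HasDerivAt (fun s : ℝ => 1 - s ^ 2) (-(2 * y)) y := by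
    simpa using (hasDerivAt_pow 2 y).const_sub 1
  refine (h.sqrt hp.ne').congr_deriv ?_
  field_simp

theorem hasDerivAt_arccos_strip (hy : 0 < y) (hy1 : y < 1) :
    HasDerivAt Real.arccos (-(1 / √(1 - y ^ 2))) y :=
  Real.hasDerivAt_arccos (by linarith) hy1.ne

theorem hasDerivAt_mk {f g h : ℝ → ℝ} {f' g' h' s : ℝ} (hf : HasDerivAt f f' s)
    (hg : HasDerivAt g g' s) (hh : HasDerivAt h h' s) :
    HasDerivAt (fun s => ((⟨f s, g s⟩ : ℂ), h s)) (⟨f', g'⟩, h') s := by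
  have h1 : HasDerivAt (fun s => (⟨f s, g s⟩ : ℂ)) ⟨f', g'⟩ s := by
    rw [Complex.mk_eq_add_mul_I f' g']
    exact (hf.ofReal_comp.add (hg.ofReal_comp.mul_const Complex.I)).congr_of_eventuallyEq
      (.of_forall fun s => Complex.mk_eq_add_mul_I _ _)
  exact h1.prodMk hh

theorem pd_zero_topHalf (x : ℝ) (hy : 0 < y) (hy1 : y < 1) :
    pd 0 (topHalf parabolicCatenoid) x y = (⟨1, 0⟩, 0) := by
  have h : (fun s => topHalf parabolicCatenoid s y) = fun s => ((⟨s, y⟩ : ℂ), Real.arccos y) :=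
    funext fun s => topHalf_parabolicCatenoid s hy hy1
  simp only [pd, Matrix.cons_val_zero, h]
  exact (hasDerivAt_mk (hasDerivAt_id x) (hasDerivAt_const x y) (hasDerivAt_const x _)).deriv

theorem pd_one_topHalf (x : ℝ) (hy : 0 < y) (hy1 : y < 1) :
    pd 1 (topHalf parabolicCatenoid) x y = (⟨0, 1⟩, -(1 / √(1 - y ^ 2))) := by
  have h : (fun s => topHalf parabolicCatenoid x s) =ᶠ[𝓝 y]
      fun s => ((⟨x, s⟩ : ℂ), Real.arccos s) := by
    filter_upwards [eventually_mem_strip hy hy1] with s hs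
    exact topHalf_parabolicCatenoid x hs.1 hs.2
  simp only [pd, Matrix.cons_val_one, Matrix.cons_val_zero]
  rw [h.deriv_eq]
  exact (hasDerivAt_mk (hasDerivAt_const y x) (hasDerivAt_id y)
    (hasDerivAt_arccos_strip hy hy1)).deriv

/-- The surface is invariant under horizontal translations, so its coordinate fields do not depend
on x. -/
theorem pd_zero_pd_topHalf (j : Fin 2) (x : ℝ) (hy : 0 < y) (hy1 : y < 1) :
    pd 0 (pd j (topHalf parabolicCatenoid)) x y = 0 := by
  have h : (fun s => pd j (topHalf parabolicCatenoid) s y) =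
      fun _ => pd j (topHalf parabolicCatenoid) x y := by
    funext s
    fin_cases j
    · exact (pd_zero_topHalf s hy hy1).trans (pd_zero_topHalf x hy hy1).symm
    · exact (pd_one_topHalf s hy hy1).trans (pd_one_topHalf x hy hy1).symm
  simp only [pd, Matrix.cons_val_zero] at h ⊢
  rw [h, deriv_const]

theorem pd_one_pd_zero_topHalf (x : ℝ) (hy : 0 < y) (hy1 : y < 1) :
    pd 1 (pd 0 (topHalf parabolicCatenoid)) x y = 0 := by
  have h : (fun s => pd 0 (topHalf parabolicCatenoid) x s) =ᶠ[𝓝 y]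
      fun _ => ((⟨1, 0⟩ : ℂ), (0 : ℝ)) := by
    filter_upwards [eventually_mem_strip hy hy1] with s hs
    exact pd_zero_topHalf x hs.1 hs.2
  exact h.deriv_eq.trans (deriv_const _ _)

theorem pd_one_pd_one_topHalf (x : ℝ) (hy : 0 < y) (hy1 : y < 1) :
    pd 1 (pd 1 (topHalf parabolicCatenoid)) x y =
      (⟨0, 0⟩, -(y / (√(1 - y ^ 2) * (1 - y ^ 2)))) := by
  have h : (fun s => pd 1 (topHalf parabolicCatenoid) x s) =ᶠ[𝓝 y]
      fun s => ((⟨0, 1⟩ : ℂ), -(1 / √(1 - s ^ 2))) := by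
    filter_upwards [eventually_mem_strip hy hy1] with s hs
    exact pd_one_topHalf x hs.1 hs.2
  have hp := one_sub_sq_pos hy hy1
  have hs := Real.sqrt_pos.2 hp
  have hd : HasDerivAt (fun s : ℝ => -(1 / √(1 - s ^ 2)))
      (-(y / (√(1 - y ^ 2) * (1 - y ^ 2)))) y := by
    refine (((hasDerivAt_const y (1 : ℝ)).div (hasDerivAt_sqrt_one_sub_sq hy hy1)
      hs.ne').neg).congr_deriv ?_
    rw [Real.sq_sqrt hp.le]
    field_simp
    ring
  exact h.deriv_eq.trans
    (hasDerivAt_mk (hasDerivAt_const y 0) (hasDerivAt_const y 1) hd).deriv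

theorem isUnitNormal_gaussMap (x : ℝ) (hy : 0 < y) (hy1 : y < 1) :
    IsUnitNormal (topHalf parabolicCatenoid) gaussMap x y := by
  have hp := one_sub_sq_pos hy hy1
  have hs := Real.sqrt_pos.2 hp
  refine ⟨?_, fun i => ?_⟩
  · simp only [metric, gaussMap, topHalf_parabolicCatenoid x hy hy1]
    rw [neg_mul_neg √(1 - y ^ 2), Real.mul_self_sqrt hp.le]
    field_simp
    ring
  · fin_cases i
    · simp [metric, gaussMap, pd_zero_topHalf x hy hy1]
    · simp only [metric, gaussMap, Fin.mk_one, pd_one_topHalf x hy hy1,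
        topHalf_parabolicCatenoid x hy hy1]
      field_simp
      ring

theorem firstForm_topHalf (x : ℝ) (hy : 0 < y) (hy1 : y < 1) :
    firstForm (topHalf parabolicCatenoid) x y =
      !![1 / y ^ 2, 0; 0, 1 / (y ^ 2 * (1 - y ^ 2))] := by
  have hp := one_sub_sq_pos hy hy1
  have hs := Real.sqrt_pos.2 hp
  ext i j
  fin_cases i <;> fin_cases j <;>
    simp [firstForm, metric, pd_zero_topHalf x hy hy1, pd_one_topHalf x hy hy1,
      topHalf_parabolicCatenoid x hy hy1]
  rw [← mul_inv, Real.mul_self_sqrt hp.le]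
  field_simp
  ring

theorem inv_firstForm_topHalf (x : ℝ) (hy : 0 < y) (hy1 : y < 1) :
    (firstForm (topHalf parabolicCatenoid) x y)⁻¹ =
      !![y ^ 2, 0; 0, y ^ 2 * (1 - y ^ 2)] := by
  have hp := one_sub_sq_pos hy hy1
  refine Matrix.inv_eq_right_inv ?_
  rw [firstForm_topHalf x hy hy1, Matrix.mul_fin_two, Matrix.one_fin_two]
  congr 3 <;> field_simp <;> simp

theorem sqrt_det_firstForm_topHalf (x : ℝ) (hy : 0 < y) (hy1 : y < 1) :
    √(firstForm (topHalf parabolicCatenoid) x y).det = 1 / (y ^ 2 * √(1 - y ^ 2)) := by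
  have hp := one_sub_sq_pos hy hy1
  have hs := Real.sqrt_pos.2 hp
  rw [firstForm_topHalf x hy hy1, Matrix.det_fin_two_of,
    show 1 / y ^ 2 * (1 / (y ^ 2 * (1 - y ^ 2))) - 0 * 0 = (1 / (y ^ 2 * √(1 - y ^ 2))) ^ 2 by
      rw [div_pow, mul_pow, Real.sq_sqrt hp.le]; field_simp; ring]
  exact Real.sqrt_sq (by positivity)

theorem secondForm_topHalf (x : ℝ) (hy : 0 < y) (hy1 : y < 1) :
    secondForm (topHalf parabolicCatenoid) gaussMap x y =
      !![-(1 / y), 0; 0, 1 / (y * (1 - y ^ 2))] := by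
  have hp := one_sub_sq_pos hy hy1
  have hs := Real.sqrt_pos.2 hp
  ext i j
  fin_cases i <;> fin_cases j <;>
    simp [secondForm, metric, christoffel, gaussMap, pd_zero_topHalf x hy hy1,
      pd_one_topHalf x hy hy1, pd_zero_pd_topHalf _ x hy hy1, pd_one_pd_zero_topHalf x hy hy1,
      pd_one_pd_one_topHalf x hy hy1, topHalf_parabolicCatenoid x hy hy1]
  · field_simp
  · field_simp
    ring

/-- The shape operator is diag(-y, y); its trace is zero, so the surface is minimal. -/
theorem normSqSecondForm_topHalf (x : ℝ) (hy : 0 < y) (hy1 : y < 1) :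
    normSqSecondForm (topHalf parabolicCatenoid) gaussMap x y = 2 * y ^ 2 := by
  have hp := one_sub_sq_pos hy hy1
  rw [normSqSecondForm, inv_firstForm_topHalf x hy hy1, secondForm_topHalf x hy hy1, sq,
    Matrix.mul_fin_two, Matrix.mul_fin_two, Matrix.trace_fin_two_of]
  field_simp
  ring

theorem ricci_gaussMap (x : ℝ) (hy : 0 < y) (hy1 : y < 1) :
    ricci (topHalf parabolicCatenoid x y) (gaussMap x y) = -y ^ 2 := by
  simp only [ricci, gaussMap, topHalf_parabolicCatenoid x hy hy1]
  field_simp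
  ring

/-- The Laplace–Beltrami operator of the parabolic catenoid, for functions with given partial
derivatives on the strip `0 < y < 1`. -/
theorem laplaceBeltrami_topHalf {w w₀ w₁ : ℝ → ℝ → ℝ} {x y D₀ D₁ : ℝ} (hy : 0 < y) (hy1 : y < 1)
    (h₀ : ∀ a b, 0 < b → b < 1 → pd 0 w a b = w₀ a b)
    (h₁ : ∀ a b, 0 < b → b < 1 → pd 1 w a b = w₁ a b)
    (hD₀ : HasDerivAt (fun s => 1 / √(1 - y ^ 2) * w₀ s y) D₀ x)
    (hD₁ : HasDerivAt (fun s => √(1 - s ^ 2) * w₁ x s) D₁ y) :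
    laplaceBeltrami (topHalf parabolicCatenoid) w x y = y ^ 2 * √(1 - y ^ 2) * (D₀ + D₁) := by
  have e₀ : ∀ a b, 0 < b → b < 1 →
      (∑ j, √(firstForm (topHalf parabolicCatenoid) a b).det *
        (firstForm (topHalf parabolicCatenoid) a b)⁻¹ 0 j * pd j w a b) =
      1 / √(1 - b ^ 2) * w₀ a b := by
    intro a b hb hb1
    have hs := Real.sqrt_pos.2 (one_sub_sq_pos hb hb1)
    rw [Fin.sum_univ_two, inv_firstForm_topHalf a hb hb1, sqrt_det_firstForm_topHalf a hb hb1,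
      h₀ a b hb hb1]
    simp
    field_simp
    simp
  have e₁ : ∀ a b, 0 < b → b < 1 →
      (∑ j, √(firstForm (topHalf parabolicCatenoid) a b).det *
        (firstForm (topHalf parabolicCatenoid) a b)⁻¹ 1 j * pd j w a b) =
      √(1 - b ^ 2) * w₁ a b := by
    intro a b hb hb1
    have hp := one_sub_sq_pos hb hb1
    have hs := Real.sqrt_pos.2 hp
    rw [Fin.sum_univ_two, inv_firstForm_topHalf a hb hb1, sqrt_det_firstForm_topHalf a hb hb1,
      h₁ a b hb hb1]
    simp
    field_simp
    simp [Real.sq_sqrt hp.le]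
  have hs := Real.sqrt_pos.2 (one_sub_sq_pos hy hy1)
  rw [laplaceBeltrami, sqrt_det_firstForm_topHalf x hy hy1, Fin.sum_univ_two]
  have d₀ := (hD₀.congr_of_eventuallyEq (.of_forall fun s => e₀ s y hy hy1)).deriv
  have d₁ := (hD₁.congr_of_eventuallyEq ((eventually_mem_strip hy hy1).mono
    fun s hs => e₁ x s hs.1 hs.2)).deriv
  simp only [pd, Matrix.cons_val_zero, Matrix.cons_val_one] at d₀ d₁ ⊢
  rw [d₀, d₁]
  field_simp

/-- Since Ric(ν, ν) + |A|² = -y² + 2y², the equation reduces to Δw + y² w = 0. -/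
theorem jacobiOperator_jacobiField_tallDeformation (x : ℝ) (hy : 0 < y) (hy1 : y < 1) :
    jacobiOperator (tallDeformation 0) gaussMap (jacobiField tallDeformation gaussMap) x y = 0 := by
  have hp := one_sub_sq_pos hy hy1
  have hs := Real.sqrt_pos.2 hp
  have h₀ : ∀ a b, 0 < b → b < 1 →
      pd 0 (jacobiField tallDeformation gaussMap) a b = a * b / 2 := by
    intro a b hb hb1
    simp only [pd, Matrix.cons_val_zero, jacobiField_tallDeformation _ hb hb1]
    refine HasDerivAt.deriv (((((hasDerivAt_pow 2 a).mul_const b).const_sub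
      (√(1 - b ^ 2) * Real.arccos b)).const_mul (-(1 / 4))).congr_deriv ?_)
    simp
    ring
  have h₁ : ∀ a b, 0 < b → b < 1 → pd 1 (jacobiField tallDeformation gaussMap) a b =
      1 / 4 * (b * Real.arccos b / √(1 - b ^ 2) + 1 + a ^ 2) := by
    intro a b hb hb1
    have hs := Real.sqrt_pos.2 (one_sub_sq_pos hb hb1)
    have h : (fun s => jacobiField tallDeformation gaussMap a s) =ᶠ[𝓝 b]
        fun s => -(1 / 4) * (√(1 - s ^ 2) * Real.arccos s - a ^ 2 * s) :=
      (eventually_mem_strip hb hb1).mono fun s hs => jacobiField_tallDeformation a hs.1 hs.2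
    refine h.deriv_eq.trans (HasDerivAt.deriv (((((hasDerivAt_sqrt_one_sub_sq hb hb1).mul
      (hasDerivAt_arccos_strip hb hb1)).sub
      ((hasDerivAt_id b).const_mul (a ^ 2))).const_mul (-(1 / 4))).congr_deriv ?_))
    field_simp
    ring
  have hD₀ : HasDerivAt (fun s => 1 / √(1 - y ^ 2) * (s * y / 2)) (y / (2 * √(1 - y ^ 2))) x := by
    refine ((((hasDerivAt_id x).mul_const y).div_const 2).const_mul _).congr_deriv ?_
    field_simp
  have hD₁ : HasDerivAt
      (fun s => √(1 - s ^ 2) * (1 / 4 * (s * Real.arccos s / √(1 - s ^ 2) + 1 + x ^ 2)))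
      (1 / 4 * (Real.arccos y - (2 * y + x ^ 2 * y) / √(1 - y ^ 2))) y := by
    -- The weight √(1 - s²) cancels the denominator of the y-derivative; the simplified flux is
    -- differentiated instead.
    have h : HasDerivAt (fun s => 1 / 4 * (s * Real.arccos s + √(1 - s ^ 2) * (1 + x ^ 2)))
        (1 / 4 * (Real.arccos y - (2 * y + x ^ 2 * y) / √(1 - y ^ 2))) y := by
      refine ((((hasDerivAt_id y).mul (hasDerivAt_arccos_strip hy hy1)).add
        ((hasDerivAt_sqrt_one_sub_sq hy hy1).mul_const (1 + x ^ 2))).const_mul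
          (1 / 4)).congr_deriv ?_
      simp only [id]
      field_simp
      ring
    refine h.congr_of_eventuallyEq ((eventually_mem_strip hy hy1).mono fun s hs => ?_)
    have := Real.sqrt_pos.2 (one_sub_sq_pos hs.1 hs.2)
    simp only
    field_simp
    ring
  rw [jacobiOperator, tallDeformation_zero, laplaceBeltrami_topHalf hy hy1 h₀ h₁ hD₀ hD₁,
    ricci_gaussMap x hy hy1, normSqSecondForm_topHalf x hy hy1,
    jacobiField_tallDeformation x hy hy1]
  field_simp
  ring

end HypProd

end

/-! ### The main theorem -/

theorem mainTheorem3 :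
    -- the surfaces `Y_d` converge to the parabolic catenoid through the origin as `d → 0`
    HypProd.ConvergesSmoothly HypProd.halfSpace HypProd.dilatedTallRectangle (𝓝[>] 0)
      HypProd.parabolicCatenoid ∧
    ∀ x y : ℝ, 0 < y → y < 1 →
      -- the top half of the parabolic catenoid is the graph of `arccos y`, with Gauss map `ν`
      HypProd.tallDeformation 0 x y = (⟨x, y⟩, Real.arccos y) ∧
      HypProd.catDeformation 0 x y = (⟨x, y⟩, Real.arccos y) ∧
      HypProd.IsUnitNormal (HypProd.tallDeformation 0) HypProd.gaussMap x y ∧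
      -- for small parameters both families are bigraphs over `(x, y)`
      (∀ᶠ d in 𝓝[>] (0 : ℝ), ∃ h : ℝ, 0 < h ∧
        {t : ℝ | ((⟨x, y⟩ : ℂ), t) ∈ HypProd.dilatedTallRectangle d} = {h, -h}) ∧
      (∀ᶠ κ in 𝓝[>] (0 : ℝ), ∃ h : ℝ, 0 < h ∧
        {t : ℝ | ((⟨x, y⟩ : ℂ), t) ∈ HypProd.dilatedCatenoid κ} = {h, -h}) ∧
      -- both deformations are differentiable at parameter `0⁺`
      DifferentiableWithinAt ℝ (fun ε => HypProd.tallDeformation ε x y) (Ici 0) 0 ∧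
      DifferentiableWithinAt ℝ (fun κ => HypProd.catDeformation κ x y) (Ici 0) 0 ∧
      -- the Jacobi field of the deformation into tall rectangles
      HypProd.jacobiField HypProd.tallDeformation HypProd.gaussMap x y =
        -(1 / 4) * (√(1 - y ^ 2) * Real.arccos y - x ^ 2 * y) ∧
      -- it is the negative of the Jacobi field of the deformation into catenoids
      HypProd.jacobiField HypProd.tallDeformation HypProd.gaussMap x y =
        -HypProd.jacobiField HypProd.catDeformation HypProd.gaussMap x y ∧
      -- and it solves the Jacobi equation of the parabolic catenoid
      HypProd.jacobiOperator (HypProd.tallDeformation 0) HypProd.gaussMap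
        (HypProd.jacobiField HypProd.tallDeformation HypProd.gaussMap) x y = 0 := by
  refine ⟨HypProd.convergesSmoothly_dilatedTallRectangle, fun x y hy hy1 => ?_⟩
  have hJ := HypProd.jacobiField_tallDeformation x hy hy1
  refine ⟨?_, ?_, ?_, ?_, ?_,
    (HypProd.hasDerivWithinAt_tallDeformation x hy hy1).differentiableWithinAt,
    (HypProd.hasDerivWithinAt_catDeformation x hy hy1).differentiableWithinAt, hJ, ?_,
    HypProd.jacobiOperator_jacobiField_tallDeformation x hy hy1⟩
  · rw [HypProd.tallDeformation_zero, HypProd.topHalf_parabolicCatenoid x hy hy1]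
  · rw [HypProd.catDeformation_zero, HypProd.topHalf_parabolicCatenoid x hy hy1]
  · rw [HypProd.tallDeformation_zero]
    exact HypProd.isUnitNormal_gaussMap x hy hy1
  -- The bigraph property is known in the parameter ε = d² and is transferred to d.
  · have hsq : Tendsto (fun d : ℝ => d ^ 2) (𝓝[>] 0) (𝓝[>] 0) := by
      refine tendsto_nhdsWithin_iff.2 ⟨?_, ?_⟩
      · exact ((continuous_pow 2).tendsto' 0 0 (by simp)).mono_left nhdsWithin_le_nhds
      · filter_upwards [self_mem_nhdsWithin] with d hd
        exact pow_pos (mem_Ioi.1 hd) 2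
    filter_upwards [hsq.eventually (HypProd.eventually_setOf_dilatedTallRectangle x hy hy1),
      self_mem_nhdsWithin] with d hd hd0
    rw [Real.sqrt_sq (mem_Ioi.1 hd0).le] at hd
    exact ⟨_, hd⟩
  · filter_upwards [HypProd.eventually_setOf_dilatedCatenoid x hy hy1] with κ hκ
    exact ⟨_, hκ⟩
  · rw [hJ, HypProd.jacobiField_catDeformation x hy hy1]
    ring
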